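/- Let $G$ be a compact Lie group with Lie algebra $\mathfrak g$, and let $U$ and $V$ be strongly continuous unitary representations of $G$ on complex Hilbert spaces $\mathcal H$ and $\mathcal K$. Let $\psi\in\mathcal H$ and $\phi\in\mathcal K$ be unit vectors and let $R>0$. A quantum channel (a linear, completely positive, trace-preserving map $\mathcal E$ between trace-class operators) is $G$-covariant if $\mathcal E(U_{\rm in}(g)\,\cdot\,U_{\rm in}(g)^\dagger)=U_{\rm out}(g)\,\mathcal E(\cdot)\,U_{\rm out}(g)^\dagger$ for all $g\in G$. There is an asymptotic $G$-covariant transformation from $\psi$ to $\phi$ at rate $R$ if for every $N\in\mathbb N$ there are a density operator $\sigma_N$ on $\mathcal K^{\otimes M(N)}$, $M(N)=\lfloor NR\rfloor$, and a $G$-covariant channel (for the representations $U^{\otimes N}$ and $V^{\otimes M(N)}$) taking $|\psi\rangle\langle\psi|^{\otimes N}$ to $\sigma_N$, such that $\lim_{N\to\infty}\mathrm{Fid}(\sigma_N,|\phi\rangle\langle\phi|^{\otimes M(N)})=1$, where $\mathrm{Fid}(\rho,\sigma)=\mathrm{tr}\sqrt{\sqrt\sigma\,\rho\,\sqrt\sigma}$.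 It is reversible if moreover there is an asymptotic $G$-covariant transformation from $\phi$ to $\psi$ at rate $R^{-1}$. Suppose there is a reversible asymptotic $G$-covariant transformation between $\psi$ and $\phi$ at rate $R$. Then: (i) $\mathrm{Sym}_G(\psi)=\mathrm{Sym}_G(\phi)$, where $\mathrm{Sym}_G(\psi)=\{g\in G: U(g)|\psi\rangle\langle\psi|U(g)^\dagger=|\psi\rangle\langle\psi|\}$, and likewise for $\phi$ with $V$. Assume in addition that $\psi$ and $\phi$ lie in the common domain of the generators of the respective representation, i.e. that $g\mapsto U(g)\psi$ and $g\mapsto V(g)\phi$ are differentiable at the identity (which is automatic for finite-dimensional representations). For $X\in\mathfrak g$ let $L_X$ be the corresponding generator, $L_X\psi=-i\,\frac{d}{dt}\big|_{t=0}U(e^{tX})\psi$, put $\langle L_X\rangle_\psi=\langle\psi|L_X|\psi\rangle$, and use the same notation for $\phi$ and $V$. Then: (ii) for every basis $(X_k)$ of $\mathfrak g$, with $L_k=L_{X_k}$ and $[C_{\mathfrak g}(\psi)]_{kl}=\tfrac12\big(\langle L_k\psi|L_l\psi\rangle+\langle L_l\psi|L_k\psi\rangle\big)-\langle L_k\rangle_\psi\langle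 L_l\rangle_\psi$ (that is, $\tfrac12\langle\psi|L_kL_l+L_lL_k|\psi\rangle-\langle\psi|L_k|\psi\rangle\langle\psi|L_l|\psi\rangle$), one has $C_{\mathfrak g}(\psi)=R\,C_{\mathfrak g}(\phi)$; (iii) $\langle L_X\rangle_\psi=R\,\langle L_X\rangle_\phi$ for every $X$ in the commutator subalgebra $[\mathfrak g,\mathfrak g]$. -/

import Mathlib

open Filter Topology
open scoped TensorProduct Manifold ContDiff

namespace Asymmetry

universe u v w

noncomputable section

/-! ### Trace-class operators, density operators, channels, fidelity -/

section Operators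

variable {A : Type u} [NormedAddCommGroup A] [InnerProductSpace ℂ A] [CompleteSpace A]
variable {B : Type w} [NormedAddCommGroup B] [InnerProductSpace ℂ B] [CompleteSpace B]

/-- A positive operator with finite trace. -/
def IsPosTraceClass (T : A →L[ℂ] A) : Prop :=
  T.IsPositive ∧ ∀ (ι : Type u) (b : HilbertBasis ι ℂ A),
    Summable fun i => inner ℂ (b i) (T (b i))

variable (A) in
/-- The trace-class operators: linear combinations of positive operators with finite trace. -/
def traceClass : Submodule ℂ (A →L[ℂ] A) :=
  Submodule.span ℂ {T | IsPosTraceClass T}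

variable (A) in
/-- An index set of an orthonormal basis of `A`. -/
def basisSet : Set A := (exists_hilbertBasis ℂ A).choose

variable (A) in
/-- An orthonormal basis of `A`. -/
def someBasis : HilbertBasis (basisSet A) ℂ A :=
  (exists_hilbertBasis ℂ A).choose_spec.choose

/-- The trace of an operator (on trace-class operators it does not depend on the basis). -/
def tr (T : A →L[ℂ] A) : ℂ :=
  ∑' i, inner ℂ (someBasis A i) (T (someBasis A i))

open scoped ComplexOrder in
/-- Positivity of the operator `∑ i j, |i⟩⟨j| ⊗ T i j` on `ℂⁿ ⊗ A`. -/
def BlockPositive {n : ℕ} (T : Fin n → Fin n → (A →L[ℂ] A)) : Prop :=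
  ∀ x : Fin n → A, 0 ≤ ∑ i, ∑ j, inner ℂ (x i) (T i j (x j))

variable (A B) in
/-- A quantum channel: a linear, completely positive, trace-preserving map from the trace-class
operators on `A` to the trace-class operators on `B`. -/
structure Channel where
  map : traceClass A →ₗ[ℂ] traceClass B
  completelyPositive : ∀ (n : ℕ) (T : Fin n → Fin n → traceClass A),
    BlockPositive (fun i j => (T i j : A →L[ℂ] A)) →
      BlockPositive (fun i j => (map (T i j) : B →L[ℂ] B))
  tracePreserving : ∀ T : traceClass A, tr (map T : B →L[ℂ] B) = tr (T : A →L[ℂ] A)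

variable (A) in
/-- A density operator: a positive operator of trace one. -/
structure DensityOp where
  op : A →L[ℂ] A
  isPosTraceClass : IsPosTraceClass op
  tr_eq_one : tr op = 1

/-- A density operator as a trace-class operator. -/
def DensityOp.toTraceClass (ρ : DensityOp A) : traceClass A :=
  ⟨ρ.op, Submodule.subset_span ρ.isPosTraceClass⟩

/-- The fidelity `tr √(√σ ρ √σ)` of two states. -/
def fid (ρ σ : DensityOp A) : ℝ :=
  (tr (CFC.sqrt (CFC.sqrt σ.op * ρ.op * CFC.sqrt σ.op))).re

/-- Conjugation `T ↦ u T u†` by a unitary operator. -/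
def conj (u : A ≃ₗᵢ[ℂ] A) (T : A →L[ℂ] A) : A →L[ℂ] A :=
  (u.toContinuousLinearEquiv : A →L[ℂ] A) ∘L T ∘L
    ContinuousLinearMap.adjoint (u.toContinuousLinearEquiv : A →L[ℂ] A)

theorem conj_apply (u : A ≃ₗᵢ[ℂ] A) (T : A →L[ℂ] A) (x : A) :
    conj u T x = u (T (u.symm x)) := by
  have h : ContinuousLinearMap.adjoint (u.toContinuousLinearEquiv : A →L[ℂ] A) x
      = u.symm x := by
    refine ext_inner_left ℂ fun y => ?_
    rw [ContinuousLinearMap.adjoint_inner_right]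
    rw [← u.inner_map_map y (u.symm x)]
    simp
  change u (T (ContinuousLinearMap.adjoint (u.toContinuousLinearEquiv : A →L[ℂ] A) x)) = _
  rw [h]

theorem isPosTraceClass_conj (u : A ≃ₗᵢ[ℂ] A) {T : A →L[ℂ] A} (hT : IsPosTraceClass T) :
    IsPosTraceClass (conj u T) := by
  refine ⟨hT.1.conj_adjoint (u.toContinuousLinearEquiv : A →L[ℂ] A), fun ι b => ?_⟩
  have ho : Orthonormal ℂ (fun i => u.symm (b i)) :=
    b.orthonormal.comp_linearIsometry u.symm.toLinearIsometry
  have h := hT.2 ι (HilbertBasis.mk ho (by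
      have hb := b.dense_span
      have hr : Set.range (fun i => u.symm (b i)) = u.symm '' Set.range b := by
        rw [← Set.range_comp]; rfl
      intro x _
      rw [hr]
      have h1 : u x ∈ closure ((Submodule.span ℂ (Set.range b) : Submodule ℂ A) : Set A) := by
        rw [← Submodule.topologicalClosure_coe, hb]; trivial
      have h2 : u.symm (u x) ∈ u.symm '' closure
          ((Submodule.span ℂ (Set.range b) : Submodule ℂ A) : Set A) := ⟨_, h1, rfl⟩
      have h3 := image_closure_subset_closure_image u.symm.continuous h2
      rw [u.symm_apply_apply] at h3
      change x ∈ closure _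
      convert h3 using 2
      ext z
      have h4 := Submodule.map_span (u.symm.toLinearEquiv : A →ₗ[ℂ] A) (Set.range b)
      have h5 := congrArg (fun S : Submodule ℂ A => z ∈ S) h4
      simp only [Submodule.mem_map] at h5
      exact (iff_of_eq h5).symm))
  refine h.congr fun i => ?_
  rw [HilbertBasis.coe_mk, conj_apply, ← u.inner_map_map]
  simp

theorem conj_mem_traceClass (u : A ≃ₗᵢ[ℂ] A) (T : traceClass A) :
    conj u (T : A →L[ℂ] A) ∈ traceClass A := by
  obtain ⟨T, hT⟩ := T
  change conj u T ∈ traceClass A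
  induction hT using Submodule.span_induction with
  | mem x hx => exact Submodule.subset_span (isPosTraceClass_conj u hx)
  | zero => simp [conj]
  | add x y _ _ hx hy =>
    have : conj u (x + y) = conj u x + conj u y := by ext z; simp [conj]
    rw [this]; exact Submodule.add_mem _ hx hy
  | smul c x _ hx =>
    have : conj u (c • x) = c • conj u x := by ext z; simp [conj]
    rw [this]; exact Submodule.smul_mem _ _ hx

/-- Conjugation by a unitary operator on the trace-class operators. -/
def conjTC (u : A ≃ₗᵢ[ℂ] A) (T : traceClass A) : traceClass A :=
  ⟨conj u T, conj_mem_traceClass u T⟩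

theorem hasSum_rankOne (ψ : A) {ι : Type*} (b : HilbertBasis ι ℂ A) :
    HasSum (fun i => inner ℂ (b i) (InnerProductSpace.rankOne ℂ ψ ψ (b i))) (inner ℂ ψ ψ) := by
  have h : (fun i => inner ℂ (b i) (InnerProductSpace.rankOne ℂ ψ ψ (b i)))
      = fun i => inner ℂ ψ (b i) * inner ℂ (b i) ψ := by
    funext i
    rw [InnerProductSpace.rankOne_apply, inner_smul_right]
  rw [h]
  exact b.hasSum_inner_mul_inner ψ ψ

/-- The density operator `|ψ⟩⟨ψ|` of a unit vector. -/
def pureState (ψ : A) (hψ : ‖ψ‖ = 1) : DensityOp A where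
  op := InnerProductSpace.rankOne ℂ ψ ψ
  isPosTraceClass := ⟨InnerProductSpace.isPositive_rankOne_self ψ,
    fun _ b => (hasSum_rankOne ψ b).summable⟩
  tr_eq_one := by
    rw [tr, (hasSum_rankOne ψ (someBasis A)).tsum_eq, inner_self_eq_norm_sq_to_K, hψ]
    simp

end Operators

/-! ### Hilbert spaces with a unitary group action and their tensor powers -/

/-- A complex Hilbert space with an action of `G` by unitary operators. -/
structure System (G : Type v) [Group G] where
  carrier : Type u
  [normedAddCommGroup : NormedAddCommGroup carrier]
  [innerProductSpace : InnerProductSpace ℂ carrier]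
  [completeSpace : CompleteSpace carrier]
  U : G →* (carrier ≃ₗᵢ[ℂ] carrier)

attribute [instance] System.normedAddCommGroup System.innerProductSpace System.completeSpace

section Completion

variable {V : Type*} [NormedAddCommGroup V] [InnerProductSpace ℂ V]

/-- The extension of a unitary operator of an inner product space to the completion. -/
def completionIso (f : V ≃ₗᵢ[ℂ] V) :
    UniformSpace.Completion V ≃ₗᵢ[ℂ] UniformSpace.Completion V where
  toFun := (f.toContinuousLinearEquiv : V →L[ℂ] V).completion
  invFun := (f.symm.toContinuousLinearEquiv : V →L[ℂ] V).completion
  map_add' := map_add _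
  map_smul' := map_smul _
  left_inv x := by
    induction x using UniformSpace.Completion.induction_on with
    | hp => exact isClosed_eq (by fun_prop) (by fun_prop)
    | ih a => simp
  right_inv x := by
    induction x using UniformSpace.Completion.induction_on with
    | hp => exact isClosed_eq (by fun_prop) (by fun_prop)
    | ih a => simp
  norm_map' x := by
    induction x using UniformSpace.Completion.induction_on with
    | hp =>
      exact isClosed_eq
        ((f.toContinuousLinearEquiv : V →L[ℂ] V).completion.continuous.norm) continuous_norm
    | ih a =>
      change ‖(f.toContinuousLinearEquiv : V →L[ℂ] V).completion a‖ = _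
      simp

theorem completionIso_coe (f : V ≃ₗᵢ[ℂ] V) (x : V) :
    completionIso f (x : UniformSpace.Completion V) = ((f x : V) : UniformSpace.Completion V) :=
  ContinuousLinearMap.completion_apply_coe _ x

theorem completionIso_one : completionIso (1 : V ≃ₗᵢ[ℂ] V) = 1 := by
  ext x
  induction x using UniformSpace.Completion.induction_on with
  | hp => exact isClosed_eq (completionIso 1).continuous continuous_id
  | ih a => rw [completionIso_coe]; rfl

theorem completionIso_mul (f g : V ≃ₗᵢ[ℂ] V) :
    completionIso (f * g) = completionIso f * completionIso g := by
  ext x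
  induction x using UniformSpace.Completion.induction_on with
  | hp =>
    exact isClosed_eq (completionIso (f * g)).continuous
      (completionIso f * completionIso g).continuous
  | ih a =>
    change _ = completionIso f (completionIso g a)
    simp only [completionIso_coe]
    rfl

end Completion

variable {G : Type v} [Group G]

/-- The one-dimensional system with trivial action. -/
def System.unit (G : Type v) [Group G] : System.{u, v} G where
  carrier := EuclideanSpace ℂ PUnit.{u + 1}
  U := 1

/-- The (completed) tensor product of two systems, with action `U(g) ⊗ V(g)`. -/
def System.tensor (S T : System.{u, v} G) : System.{u, v} G where
  carrier := UniformSpace.Completion (S.carrier ⊗[ℂ] T.carrier)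
  U :=
    { toFun := fun g => completionIso (TensorProduct.congrIsometry (S.U g) (T.U g))
      map_one' := by
        rw [← completionIso_one]
        congr 1
        simp only [map_one]
        exact TensorProduct.congrIsometry_refl_refl
      map_mul' := fun g h => by
        rw [← completionIso_mul]
        congr 1
        simp only [map_mul]
        ext x
        induction x using TensorProduct.induction_on with
        | zero => simp
        | tmul a b => rfl
        | add a b ha hb => simp only [map_add, ha, hb] }

/-- The tensor power of a system. -/
def System.power (S : System.{u, v} G) : ℕ → System.{u, v} G
  | 0 => System.unit G
  | n + 1 => (S.power n).tensor S

/-- The vector `ψ ⊗ ⋯ ⊗ ψ` in the tensor power. -/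
def System.powerVec (S : System.{u, v} G) (ψ : S.carrier) : (n : ℕ) → (S.power n).carrier
  | 0 => (EuclideanSpace.single PUnit.unit 1 : EuclideanSpace ℂ PUnit.{u + 1})
  | n + 1 => ((S.powerVec ψ n ⊗ₜ[ℂ] ψ : (S.power n).carrier ⊗[ℂ] S.carrier) :
      UniformSpace.Completion ((S.power n).carrier ⊗[ℂ] S.carrier))

theorem System.norm_powerVec (S : System.{u, v} G) {ψ : S.carrier} (hψ : ‖ψ‖ = 1) (n : ℕ) :
    ‖S.powerVec ψ n‖ = 1 := by
  induction n with
  | zero =>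
    change ‖(EuclideanSpace.single PUnit.unit 1 : EuclideanSpace ℂ PUnit.{u + 1})‖ = 1
    simp
  | succ n ih =>
    change ‖((S.powerVec ψ n ⊗ₜ[ℂ] ψ : (S.power n).carrier ⊗[ℂ] S.carrier) :
      UniformSpace.Completion ((S.power n).carrier ⊗[ℂ] S.carrier))‖ = 1
    rw [UniformSpace.Completion.norm_coe, TensorProduct.norm_tmul, ih, hψ, mul_one]

/-- The state `ψ^{⊗ n}`. -/
def System.powerState (S : System.{u, v} G) (ψ : S.carrier) (hψ : ‖ψ‖ = 1) (n : ℕ) :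
    DensityOp (S.power n).carrier :=
  pureState (S.powerVec ψ n) (S.norm_powerVec hψ n)

/-! ### Covariant transformations -/

/-- A channel is `G`-covariant if `ℰ(U(g) T U(g)†) = V(g) ℰ(T) V(g)†` for all `g`. -/
def IsCovariant (S : System.{u, v} G) (T : System.{w, v} G) (E : Channel S.carrier T.carrier) : Prop :=
  ∀ (g : G) (X : traceClass S.carrier), E.map (conjTC (S.U g) X) = conjTC (T.U g) (E.map X)

/-- Some `G`-covariant channel takes `ρ` to `σ`. -/
def CovariantlyConvertible (S : System.{u, v} G) (T : System.{w, v} G)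
    (ρ : DensityOp S.carrier) (σ : DensityOp T.carrier) : Prop :=
  ∃ E : Channel S.carrier T.carrier, IsCovariant S T E ∧ E.map ρ.toTraceClass = σ.toTraceClass

/-- There is an asymptotic `G`-covariant transformation from `ψ` to `φ` at rate `R`. -/
def AsymptoticallyConvertible (S : System.{u, v} G) (T : System.{w, v} G) (ψ : S.carrier) (hψ : ‖ψ‖ = 1)
    (φ : T.carrier) (hφ : ‖φ‖ = 1) (R : ℝ) : Prop :=
  ∃ σ : (N : ℕ) → DensityOp (T.power ⌊(N : ℝ) * R⌋₊).carrier,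
    (∀ N : ℕ, CovariantlyConvertible (S.power N) (T.power ⌊(N : ℝ) * R⌋₊)
      (S.powerState ψ hψ N) (σ N)) ∧
    Tendsto (fun N : ℕ => fid (σ N) (T.powerState φ hφ ⌊(N : ℝ) * R⌋₊)) atTop (𝓝 1)

/-- There is a reversible asymptotic `G`-covariant transformation from `ψ` to `φ` at rate `R`. -/
def ReversiblyConvertible (S : System.{u, v} G) (T : System.{w, v} G) (ψ : S.carrier) (hψ : ‖ψ‖ = 1)
    (φ : T.carrier) (hφ : ‖φ‖ = 1) (R : ℝ) : Prop :=
  AsymptoticallyConvertible S T ψ hψ φ hφ R ∧ AsymptoticallyConvertible T S φ hφ ψ hψ R⁻¹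

/-- The symmetries of a state: the `g` with `U(g) ρ U(g)† = ρ`. -/
def sym (S : System.{u, v} G) (ρ : DensityOp S.carrier) : Set G :=
  {g | conj (S.U g) ρ.op = ρ.op}

/-! ### Generators, expectation values and covariance matrices -/

section Lie

/-- A smooth real Lie group is in particular of the class that the Lie bracket needs. -/
instance instLieGroupMinSmoothness {E : Type*} [NormedAddCommGroup E] [NormedSpace ℝ E] {G : Type*} [Group G]
    [TopologicalSpace G] [ChartedSpace E G] [LieGroup 𝓘(ℝ, E) ∞ G] :
    LieGroup 𝓘(ℝ, E) (minSmoothness ℝ 3) G :=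
  LieGroup.of_le (n := ∞) (by
    rw [minSmoothness_of_isRCLikeNormedField]
    exact ENat.LEInfty.out)

variable {E : Type*} [NormedAddCommGroup E] [NormedSpace ℝ E]
  [TopologicalSpace G] [ChartedSpace E G]

variable (E) in
/-- `ψ` lies in the common domain of the generators of the representation: the orbit map
`g ↦ U(g) ψ` is differentiable at the identity. -/
def InGeneratorDomain (S : System.{u, v} G) (ψ : S.carrier) : Prop :=
  MDifferentiableAt 𝓘(ℝ, E) 𝓘(ℝ, S.carrier) (fun g : G => S.U g ψ) 1

/-- The vector `L_X ψ`, where `L_X = -i dU(X)` is the self-adjoint generator of the one-parameter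
group of unitaries that belongs to the Lie algebra element `X`. -/
def genApply (S : System.{u, v} G) (X : GroupLieAlgebra 𝓘(ℝ, E) G) (ψ : S.carrier) : S.carrier :=
  (-Complex.I) • (show S.carrier from
    mfderiv 𝓘(ℝ, E) 𝓘(ℝ, S.carrier) (fun g : G => S.U g ψ) 1 X)

/-- The expectation value `⟨ψ| L_X |ψ⟩`. -/
def expect (S : System.{u, v} G) (X : GroupLieAlgebra 𝓘(ℝ, E) G) (ψ : S.carrier) : ℂ :=
  inner ℂ ψ (genApply S X ψ)

/-- The covariance matrix
`1/2 ⟨ψ| L_k L_l + L_l L_k |ψ⟩ - ⟨ψ| L_k |ψ⟩ ⟨ψ| L_l |ψ⟩`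
for a basis of the Lie algebra; as `L_k` is self-adjoint, `⟨ψ| L_k L_l |ψ⟩` is the inner product of
`L_k ψ` and `L_l ψ`. -/
def covMatrix (S : System.{u, v} G) {κ : Type*} (b : Module.Basis κ ℝ (GroupLieAlgebra 𝓘(ℝ, E) G))
    (ψ : S.carrier) : Matrix κ κ ℂ :=
  Matrix.of fun k l =>
    1 / 2 * (inner ℂ (genApply S (b k) ψ) (genApply S (b l) ψ)
      + inner ℂ (genApply S (b l) ψ) (genApply S (b k) ψ))
      - expect S (b k) ψ * expect S (b l) ψ

end Lie

end

end Asymmetry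

/-! Everything is read off the characteristic functions χ_ψ(g) = ⟨ψ|U(g)ψ⟩ and χ_φ(g) = ⟨φ|V(g)φ⟩,
which become powers under tensor powers. Let ℰ be a covariant channel taking Ψ close to Φ. Applied
to |U(g)Ψ⟩⟨Ψ|, it gives an operator with trace χ_Ψ(g), which must be concentrated near |V(g)Φ⟩⟨Φ|,
being an off-diagonal block of a positive 2×2 block operator whose diagonal blocks are nearly pure.
Hence χ_Ψ ≈ χ_Φ · f, where f is a matrix element of ℰ(|U(g)Ψ⟩⟨Ψ|); complete positivity and
covariance make f positive definite. For the asymptotic transformation this reads χ_ψ^N = χ_φ^M f_N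
+ o(1), uniformly in g, with |f_N| ≤ 1 and f_N(1) → 1
(`AsymptoticallyConvertible.exists_isPosDefFun`).

(i) The symmetries are the points with |χ| = 1. If |χ_ψ(g)| = 1, the relation forces |χ_φ(g)| = 1;
the reverse transformation gives the other inclusion.

(ii) Along g_N ≈ 1 + X/√N the moduli |χ_ψ|^N and |χ_φ|^M tend to Gaussians exp(-Var/2) and exp(-R
Var/2). As |f_N| ≤ 1, the variances of L_X satisfy R Var_φ ≤ Var_ψ, and the reverse transformation
gives equality. Polarization gives the covariance matrix.

(iii) Since the variances match, |f_N| → 1 along g_N and along k_N ≈ 1 + Y/√N. A positive definite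
function nearly of modulus one at two points is nearly one at their commutator
(`IsPosDefFun.norm_commutator_sub_le`), so f_N drops out there. The commutator is 1 + [X,Y]/N to
leading order (`tendsto_inv_sq_smul_commutator`), so χ_ψ^N and χ_φ^M tend to exponentials of the
first moments of [X,Y], the second multiplied by R, and these exponentials agree. -/

namespace Asymmetry

universe u v w

/-! ### Rank-one operators and traces of off-diagonal blocks -/

section ChannelEstimates

variable {A : Type u} [NormedAddCommGroup A] [InnerProductSpace ℂ A] [CompleteSpace A]
variable {B : Type w} [NormedAddCommGroup B] [InnerProductSpace ℂ B] [CompleteSpace B]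

theorem rankOne_self_mem_traceClass (x : A) :
    InnerProductSpace.rankOne ℂ x x ∈ traceClass A :=
  Submodule.subset_span ⟨InnerProductSpace.isPositive_rankOne_self x,
    fun _ b => (hasSum_rankOne x b).summable⟩

theorem rankOne_mem_traceClass (x y : A) : InnerProductSpace.rankOne ℂ x y ∈ traceClass A := by
  have h : InnerProductSpace.rankOne ℂ x y = (1 / 4 : ℂ) •
      (InnerProductSpace.rankOne ℂ (x + y) (x + y)
        - InnerProductSpace.rankOne ℂ (x - y) (x - y)
        + Complex.I • InnerProductSpace.rankOne ℂ (x + Complex.I • y) (x + Complex.I • y)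
        - Complex.I • InnerProductSpace.rankOne ℂ (x - Complex.I • y) (x - Complex.I • y)) := by
    ext z
    simp only [InnerProductSpace.rankOne_apply, smul_apply,
      add_apply, sub_apply, inner_add_left,
      inner_sub_left, inner_smul_left, Complex.conj_I]
    match_scalars <;> ring_nf <;> simp only [Complex.I_sq] <;> ring
  rw [h]
  refine Submodule.smul_mem _ _ (Submodule.sub_mem _ (Submodule.add_mem _ (Submodule.sub_mem _ ?_ ?_)
    (Submodule.smul_mem _ _ ?_)) (Submodule.smul_mem _ _ ?_)) <;>
  exact rankOne_self_mem_traceClass _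

/-- The operator `|x⟩⟨y|` as a trace-class operator. -/
noncomputable def ketBra (x y : A) : traceClass A :=
  ⟨InnerProductSpace.rankOne ℂ x y, rankOne_mem_traceClass x y⟩

theorem conjTC_ketBra (u : A ≃ₗᵢ[ℂ] A) (x y : A) :
    conjTC u (ketBra x y) = ketBra (u x) (u y) := by
  apply Subtype.ext
  ext z
  change conj u (InnerProductSpace.rankOne ℂ x y) z = InnerProductSpace.rankOne ℂ (u x) (u y) z
  rw [conj_apply, InnerProductSpace.rankOne_apply, InnerProductSpace.rankOne_apply, map_smul,
    ← u.inner_map_map y, u.apply_symm_apply]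

theorem tr_ketBra (x y : A) : tr (ketBra x y : A →L[ℂ] A) = inner ℂ y x := by
  rw [tr, ← (someBasis A).tsum_inner_mul_inner y x]
  congr 1
  funext i
  change inner ℂ _ (InnerProductSpace.rankOne ℂ x y _) = _
  rw [InnerProductSpace.rankOne_apply, inner_smul_right]

open scoped ComplexOrder in
theorem blockPositive_ketBra {n : ℕ} (v : Fin n → A) :
    BlockPositive (fun i j => (ketBra (v i) (v j) : A →L[ℂ] A)) := by
  intro x
  have h : ∑ i, ∑ j, inner ℂ (x i) ((ketBra (v i) (v j) : A →L[ℂ] A) (x j))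
      = (starRingEnd ℂ) (∑ i, inner ℂ (v i) (x i)) * ∑ j, inner ℂ (v j) (x j) := by
    rw [map_sum, Finset.sum_mul_sum]
    refine Finset.sum_congr rfl fun i _ => Finset.sum_congr rfl fun j _ => ?_
    change inner ℂ _ (InnerProductSpace.rankOne ℂ (v i) (v j) _) = _
    rw [InnerProductSpace.rankOne_apply, inner_smul_right, inner_conj_symm, mul_comm]
  rw [h, mul_comm, Complex.mul_conj]
  exact_mod_cast Complex.normSq_nonneg _

omit [CompleteSpace B] in
open scoped ComplexOrder in
/-- The arithmetic-geometric form of the Cauchy-Schwarz inequality for a positive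
two-by-two block operator. -/
theorem two_mul_norm_inner_le_of_blockPositive {T : Fin 2 → Fin 2 → (B →L[ℂ] B)}
    (hT : BlockPositive T) (x y : B) :
    0 ≤ (inner ℂ x (T 0 0 x)).re ∧ 0 ≤ (inner ℂ y (T 1 1 y)).re ∧
    2 * ‖inner ℂ x (T 0 1 y)‖ ≤ (inner ℂ x (T 0 0 x)).re + (inner ℂ y (T 1 1 y)).re := by
  have key : ∀ c : ℂ, 0 ≤ (starRingEnd ℂ) c * c * inner ℂ x (T 0 0 x)
      + (starRingEnd ℂ) c * inner ℂ x (T 0 1 y) + c * inner ℂ y (T 1 0 x)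
      + inner ℂ y (T 1 1 y) := fun c => by
    have h := hT ![c • x, y]
    simp only [Fin.sum_univ_two, Matrix.cons_val_zero, Matrix.cons_val_one, inner_smul_left,
      map_smul, inner_smul_right] at h
    convert h using 1
    ring
  have hx : 0 ≤ inner ℂ x (T 0 0 x) := by
    simpa [Fin.sum_univ_two] using hT ![x, 0]
  have hy : 0 ≤ inner ℂ y (T 1 1 y) := by
    simpa [Fin.sum_univ_two] using hT ![0, y]
  rw [Complex.nonneg_iff] at hx hy
  refine ⟨hx.1, hy.1, ?_⟩
  set a := inner ℂ x (T 0 0 x)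
  set b := inner ℂ y (T 1 1 y)
  set z := inner ℂ x (T 0 1 y)
  set z' := inner ℂ y (T 1 0 x)
  -- The coefficients 1 and i make the imaginary parts show that the off-diagonal blocks are adjoint
  -- to each other.
  have h1 := key 1
  have h2 := key Complex.I
  simp only [Complex.nonneg_iff, map_one, one_mul, Complex.conj_I, Complex.add_re, Complex.add_im,
    Complex.neg_re, Complex.neg_im, Complex.mul_re, Complex.mul_im, Complex.I_re, Complex.I_im]
    at h1 h2
  have hz : z' = (starRingEnd ℂ) z := by
    apply Complex.ext
    · rw [Complex.conj_re]; linarith [h2.2, hx.2, hy.2]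
    · rw [Complex.conj_im]; linarith [h1.2, hx.2, hy.2]
  rcases eq_or_ne z 0 with h0 | h0
  · rw [h0, norm_zero]; linarith [hx.1, hy.1]
  have hn : (‖z‖ : ℂ) ≠ 0 := by exact_mod_cast norm_ne_zero_iff.2 h0
  -- This phase turns both cross terms into -‖z‖.
  have h3 := (key (-(z / ‖z‖))).1
  have e1 : (starRingEnd ℂ) (-(z / ‖z‖)) * (-(z / ‖z‖)) = 1 := by
    rw [map_neg, neg_mul_neg, map_div₀, Complex.conj_ofReal, div_mul_div_comm, mul_comm,
      Complex.mul_conj, Complex.normSq_eq_norm_sq]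
    field_simp
    push_cast; ring
  have e2 : (starRingEnd ℂ) (-(z / ‖z‖)) * z = -(‖z‖ : ℂ) := by
    rw [map_neg, map_div₀, Complex.conj_ofReal, neg_mul, div_mul_eq_mul_div, mul_comm,
      Complex.mul_conj, Complex.normSq_eq_norm_sq]
    field_simp
    push_cast; ring
  have e3 : (-(z / ‖z‖)) * z' = -(‖z‖ : ℂ) := by
    rw [hz, neg_mul, div_mul_eq_mul_div,
      Complex.mul_conj, Complex.normSq_eq_norm_sq]
    field_simp
    push_cast; ring
  rw [e1, e2, e3] at h3
  simp only [one_mul, Complex.add_re, Complex.neg_re, Complex.ofReal_re, Complex.zero_re] at h3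
  linarith

omit [CompleteSpace B] in
-- This is the trace of P K Q for P = |p⟩⟨p| and Q = |q⟩⟨q|, by Parseval.
theorem hasSum_inner_compress {ι : Type*} (b : HilbertBasis ι ℂ B) (K : B →L[ℂ] B) (p q : B) :
    HasSum (fun i => inner ℂ (inner ℂ p (b i) • p) (K (inner ℂ q (b i) • q)))
      (inner ℂ q p * inner ℂ p (K q)) := by
  refine ((b.hasSum_inner_mul_inner q p).mul_right _).congr_fun fun i => ?_
  rw [inner_smul_left, map_smul, inner_smul_right, inner_conj_symm]
  ring

/-- The trace of a positive operator of trace one outside the span of the unit vector `p`. -/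
theorem hasSum_re_inner_sub_proj {ι : Type*} (b : HilbertBasis ι ℂ B) (T : B →L[ℂ] B) (p : B)
    (hp : ‖p‖ = 1) {s : ℝ} (hT : HasSum (fun i => (inner ℂ (b i) (T (b i))).re) s) :
    HasSum (fun i => (inner ℂ (b i - inner ℂ p (b i) • p)
      (T (b i - inner ℂ p (b i) • p))).re) (s - (inner ℂ p (T p)).re) := by
  have h1 := Complex.hasSum_re (b.hasSum_inner_mul_inner p (T p))
  have h2 := Complex.hasSum_re (b.hasSum_inner_mul_inner (ContinuousLinearMap.adjoint T p) p)
  have h3 := Complex.hasSum_re (hasSum_inner_compress b T p p)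
  rw [ContinuousLinearMap.adjoint_inner_left] at h2
  rw [inner_self_eq_norm_sq_to_K, hp] at h3
  simp only [Complex.coe_algebraMap, Complex.ofReal_one, one_pow, one_mul] at h3
  have h4 := ((hT.sub h1).sub h2).add h3
  rw [show s - (inner ℂ p (T p)).re - (inner ℂ p (T p)).re + (inner ℂ p (T p)).re
    = s - (inner ℂ p (T p)).re by ring] at h4
  refine h4.congr_fun fun i => ?_
  simp only [← Complex.sub_re, ← Complex.add_re, map_sub, inner_sub_left, inner_sub_right,
    map_smul, inner_smul_left, inner_smul_right, inner_conj_symm,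
    ContinuousLinearMap.adjoint_inner_left]
  congr 1
  ring

open scoped ComplexOrder in
/-- The trace of the off-diagonal block of a positive two-by-two block operator whose diagonal
blocks are close to the pure states `p` and `q`. -/
theorem norm_tr_sub_le_of_blockPositive {T : Fin 2 → Fin 2 → (B →L[ℂ] B)}
    (hT : BlockPositive T) (h0 : tr (T 0 0) = 1) (h1 : tr (T 1 1) = 1)
    {p q : B} (hp : ‖p‖ = 1) (hq : ‖q‖ = 1) {δ : ℝ} (hδ : 0 < δ)
    (hpT : 1 - δ ^ 2 ≤ (inner ℂ p (T 0 0 p)).re) (hqT : 1 - δ ^ 2 ≤ (inner ℂ q (T 1 1 q)).re) :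
    ‖tr (T 0 1) - inner ℂ q p * inner ℂ p (T 0 1 q)‖ ≤ 2 * δ := by
  set b := someBasis B
  have hs : ∀ K : B →L[ℂ] B, tr K = 1 → HasSum (fun i => (inner ℂ (b i) (K (b i))).re) 1 := by
    intro K hK
    -- A divergent sum has the default value 0, so trace one forces convergence.
    have : Summable fun i => inner ℂ (b i) (K (b i)) := by
      by_contra hc
      rw [tr, tsum_eq_zero_of_not_summable hc] at hK
      exact zero_ne_one hK
    have h := Complex.hasSum_re this.hasSum
    change HasSum _ (tr K).re at h
    rwa [hK] at h
  -- Rescaling one vector by δ weights the two diagonal terms. The block that is small (total at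
  -- most δ²) is divided by δ and the one of size one is multiplied by δ, so each contributes at
  -- most δ.
  have scale : ∀ x y : B, ‖inner ℂ x (T 0 1 y)‖ ≤
      ((inner ℂ x (T 0 0 x)).re / δ + δ * (inner ℂ y (T 1 1 y)).re) / 2 := by
    intro x y
    have h := (two_mul_norm_inner_le_of_blockPositive hT x ((δ : ℂ) • y)).2.2
    simp only [map_smul, inner_smul_left, inner_smul_right, Complex.conj_ofReal, norm_mul,
      Complex.norm_real, Real.norm_eq_abs, abs_of_pos hδ, Complex.re_ofReal_mul] at h
    rw [show ((inner ℂ x (T 0 0 x)).re / δ + δ * (inner ℂ y (T 1 1 y)).re) / 2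
      = ((inner ℂ x (T 0 0 x)).re + δ * (δ * (inner ℂ y (T 1 1 y)).re)) / (2 * δ) by
        field_simp, le_div_iff₀ (by positivity)]
    linarith
  have scale' : ∀ x y : B, ‖inner ℂ x (T 0 1 y)‖ ≤
      (δ * (inner ℂ x (T 0 0 x)).re + (inner ℂ y (T 1 1 y)).re / δ) / 2 := by
    intro x y
    have h := (two_mul_norm_inner_le_of_blockPositive hT ((δ : ℂ) • x) y).2.2
    simp only [map_smul, inner_smul_left, inner_smul_right, Complex.conj_ofReal, norm_mul,
      Complex.norm_real, Real.norm_eq_abs, abs_of_pos hδ, Complex.re_ofReal_mul] at h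
    rw [show (δ * (inner ℂ x (T 0 0 x)).re + (inner ℂ y (T 1 1 y)).re / δ) / 2
      = (δ * (δ * (inner ℂ x (T 0 0 x)).re) + (inner ℂ y (T 1 1 y)).re) / (2 * δ) by
        field_simp, le_div_iff₀ (by positivity)]
    linarith
  have sp := hasSum_re_inner_sub_proj b (T 0 0) p hp (hs _ h0)
  have sq := hasSum_re_inner_sub_proj b (T 1 1) q hq (hs _ h1)
  have spp := Complex.hasSum_re (hasSum_inner_compress b (T 0 0) p p)
  rw [inner_self_eq_norm_sq_to_K, hp] at spp
  simp only [Complex.coe_algebraMap, Complex.ofReal_one, one_pow, one_mul] at spp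
  have hp1 : (inner ℂ p (T 0 0 p)).re ≤ 1 := by
    have := sp.nonneg fun i => (two_mul_norm_inner_le_of_blockPositive hT _ 0).1
    linarith
  have b1 := ((sp.div_const δ).add ((hs _ h1).mul_left δ)).div_const 2
  have b2 := ((spp.mul_left δ).add (sq.div_const δ)).div_const 2
  have n1 := tsum_of_norm_bounded b1 fun i => scale (b i - inner ℂ p (b i) • p) (b i)
  have n2 := tsum_of_norm_bounded b2 fun i =>
    scale' (inner ℂ p (b i) • p) (b i - inner ℂ q (b i) • q)
  have s1 := Summable.of_norm_bounded b1.summable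
    fun i => scale (b i - inner ℂ p (b i) • p) (b i)
  have s2 := Summable.of_norm_bounded b2.summable fun i =>
    scale' (inner ℂ p (b i) • p) (b i - inner ℂ q (b i) • q)
  have s3 := hasSum_inner_compress b (T 0 1) p q
  -- With P and Q the projections onto p and q, the split is T₀₁ = (1-P)T₀₁ + P T₀₁ (1-Q) + P T₀₁ Q.
  -- The first two parts have trace at most δ each.
  have e : tr (T 0 1) = (∑' i, inner ℂ (b i - inner ℂ p (b i) • p) (T 0 1 (b i)))
      + (∑' i, inner ℂ (inner ℂ p (b i) • p) (T 0 1 (b i - inner ℂ q (b i) • q)))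
      + inner ℂ q p * inner ℂ p (T 0 1 q) := by
    rw [← s3.tsum_eq, ← s1.tsum_add s2, ← (s1.add s2).tsum_add s3.summable, tr]
    congr 1
    funext i
    rw [map_sub, inner_sub_left, inner_sub_right]
    ring
  rw [e, add_sub_cancel_right]
  refine (norm_add_le _ _).trans ?_
  have c1 : (1 - (inner ℂ p (T 0 0 p)).re) / δ ≤ δ := by
    rw [div_le_iff₀ hδ]; nlinarith
  have c2 : (1 - (inner ℂ q (T 1 1 q)).re) / δ ≤ δ := by
    rw [div_le_iff₀ hδ]; nlinarith
  have c3 : δ * (inner ℂ p (T 0 0 p)).re ≤ δ := by nlinarith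
  linarith

end ChannelEstimates

/-! ### Fidelity with a pure state -/

section Fidelity

variable {A : Type u} [NormedAddCommGroup A] [InnerProductSpace ℂ A] [CompleteSpace A]

theorem DensityOp.hasSum_re_inner (σ : DensityOp A) :
    HasSum (fun i => (inner ℂ (someBasis A i) (σ.op (someBasis A i))).re) 1 := by
  have hs : Summable fun i => inner ℂ (someBasis A i) (σ.op (someBasis A i)) := by
    by_contra hc
    have h := σ.tr_eq_one
    rw [tr, tsum_eq_zero_of_not_summable hc] at h
    exact zero_ne_one h
  have h := Complex.hasSum_re hs.hasSum
  change HasSum _ (tr σ.op).re at h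
  rwa [σ.tr_eq_one] at h

open scoped ComplexOrder in
theorem DensityOp.inner_nonneg (σ : DensityOp A) (x : A) : 0 ≤ inner ℂ x (σ.op x) :=
  σ.isPosTraceClass.1.inner_nonneg_right x

theorem DensityOp.inner_eq_re (σ : DensityOp A) (x : A) :
    inner ℂ x (σ.op x) = ((inner ℂ x (σ.op x)).re : ℂ) := by
  refine Complex.ext rfl ?_
  rw [Complex.ofReal_im]
  exact (Complex.nonneg_iff.1 (σ.inner_nonneg x)).2.symm

theorem DensityOp.re_inner_le_one (σ : DensityOp A) {p : A} (hp : ‖p‖ = 1) :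
    (inner ℂ p (σ.op p)).re ≤ 1 := by
  have h := hasSum_re_inner_sub_proj (someBasis A) σ.op p hp σ.hasSum_re_inner
  have := h.nonneg fun i => (Complex.nonneg_iff.1 (σ.inner_nonneg _)).1
  linarith

/-- The projection P = |p⟩⟨p| is its own square root and PσP is a multiple of P. Fidelity thus
becomes the overlap that the block estimate needs. -/
theorem fid_pureState (σ : DensityOp A) {p : A} (hp : ‖p‖ = 1) :
    fid σ (pureState p hp) = √(inner ℂ p (σ.op p)).re := by
  set r := (inner ℂ p (σ.op p)).re with hr
  have hr0 : 0 ≤ r := (Complex.nonneg_iff.1 (σ.inner_nonneg p)).1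
  set P : A →L[ℂ] A := InnerProductSpace.rankOne ℂ p p with hP
  have hpos : 0 ≤ P := by
    rw [ContinuousLinearMap.nonneg_iff_isPositive]
    exact InnerProductSpace.isPositive_rankOne_self p
  have hpp : inner ℂ p p = (1 : ℂ) := by
    rw [inner_self_eq_norm_sq_to_K, hp]; simp
  have hPP : P * P = P := by
    ext z
    change P (P z) = P z
    simp only [hP, InnerProductSpace.rankOne_apply, inner_smul_right, hpp, mul_one]
  have h1 : CFC.sqrt P = P := CFC.sqrt_unique hPP hpos
  have h2 : P * σ.op * P = ((r : ℝ) : ℂ) • P := by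
    ext z
    change P (σ.op (P z)) = ((r : ℝ) : ℂ) • P z
    simp only [hP, InnerProductSpace.rankOne_apply, map_smul, smul_smul]
    rw [σ.inner_eq_re p, mul_comm]
  have h3 : CFC.sqrt (((r : ℝ) : ℂ) • P) = ((√r : ℝ) : ℂ) • P := by
    refine CFC.sqrt_unique ?_ ?_
    · rw [smul_mul_smul_comm, hPP, ← Complex.ofReal_mul, Real.mul_self_sqrt hr0]
    · rw [ContinuousLinearMap.nonneg_iff_isPositive] at hpos ⊢
      have := hpos.smul_of_nonneg (c := ((√r : ℝ) : ℂ)) (by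
        exact_mod_cast Real.sqrt_nonneg r)
      exact this
  rw [fid]
  change (tr (CFC.sqrt (CFC.sqrt P * σ.op * CFC.sqrt P))).re = _
  rw [h1, h2, h3]
  have h4 : tr (((√r : ℝ) : ℂ) • P) = ((√r : ℝ) : ℂ) * tr P := by
    rw [tr, tr, ← tsum_mul_left]
    congr 1
    funext i
    rw [smul_apply, inner_smul_right]
  have h5 : tr P = 1 := (pureState p hp).tr_eq_one
  rw [h4, h5, mul_one, Complex.ofReal_re]

end Fidelity

/-! ### Positive definite functions on a group -/

section PositiveDefinite

variable {G : Type v} [Group G]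

open scoped ComplexOrder in
/-- A positive definite function on a group. -/
def IsPosDefFun (f : G → ℂ) : Prop :=
  ∀ (n : ℕ) (g : Fin n → G) (x : Fin n → ℂ),
    0 ≤ ∑ i, ∑ j, (starRingEnd ℂ) (x i) * x j * f ((g j)⁻¹ * g i)

theorem IsPosDefFun.map_inv {f : G → ℂ} (hf : IsPosDefFun f) (k : G) :
    f k⁻¹ = (starRingEnd ℂ) (f k) := by
  have h0 := hf 1 ![1] ![1]
  have h1 := hf 2 ![1, k] ![1, 1]
  have h2 := hf 2 ![1, k] ![1, Complex.I]
  simp only [Fin.sum_univ_two, Fin.sum_univ_one, Matrix.cons_val_zero, Matrix.cons_val_one,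
    Matrix.cons_val_fin_one, map_one, one_mul, mul_one, inv_one, inv_mul_cancel, Complex.conj_I,
    Complex.nonneg_iff, Complex.add_im, Complex.mul_im, Complex.neg_re, Complex.neg_im,
    Complex.mul_re, Complex.I_re, Complex.I_im] at h0 h1 h2
  apply Complex.ext
  · rw [Complex.conj_re]; linarith [h0.2, h2.2]
  · rw [Complex.conj_im]; linarith [h0.2, h1.2]

open scoped ComplexOrder MatrixOrder in
-- A positive semidefinite matrix factors as C*C, and the columns of C serve as the vectors. This is
-- a GNS construction restricted to finitely many points.
theorem IsPosDefFun.exists_gram {f : G → ℂ} (hf : IsPosDefFun f) {n : ℕ} (g : Fin n → G) :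
    ∃ v : Fin n → EuclideanSpace ℂ (Fin n), ∀ i j, inner ℂ (v i) (v j) = f ((g j)⁻¹ * g i) := by
  have hM : (Matrix.of fun i j => f ((g j)⁻¹ * g i)).PosSemidef := by
    refine Matrix.PosSemidef.of_dotProduct_mulVec_nonneg (Matrix.IsHermitian.ext fun i j => ?_)
      fun x => ?_
    · rw [Matrix.of_apply, Matrix.of_apply, RCLike.star_def, ← hf.map_inv, mul_inv_rev, inv_inv]
    convert hf n g x using 1
    simp only [dotProduct, Matrix.mulVec, Finset.mul_sum, Pi.star_apply, Matrix.of_apply]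
    refine Finset.sum_congr rfl fun i _ => Finset.sum_congr rfl fun j _ => ?_
    rw [RCLike.star_def]; ring
  obtain ⟨C, hC⟩ := CStarAlgebra.nonneg_iff_eq_star_mul_self.1 hM.nonneg
  refine ⟨fun i => WithLp.toLp 2 fun k => C k i, fun i j => ?_⟩
  have h := congrFun (congrFun hC i) j
  rw [Matrix.of_apply] at h
  rw [h, Matrix.star_eq_conjTranspose, Matrix.mul_apply]
  simp only [PiLp.inner_apply, Matrix.conjTranspose_apply, RCLike.inner_apply, RCLike.star_def]
  exact Finset.sum_congr rfl fun k _ => mul_comm _ _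

theorem IsPosDefFun.norm_le {f : G → ℂ} (hf : IsPosDefFun f) (h1 : ‖f 1‖ ≤ 1) (g : G) :
    ‖f g‖ ≤ 1 := by
  obtain ⟨v, hv⟩ := hf.exists_gram ![1, g]
  have hn : ∀ i, ‖v i‖ ≤ 1 := fun i => by
    have h := hv i i
    rw [inv_mul_cancel, inner_self_eq_norm_sq_to_K] at h
    rw [← h, norm_pow] at h1
    simpa using h1
  have h := hv 1 0
  simp only [Matrix.cons_val_zero, Matrix.cons_val_one, inv_one, one_mul] at h
  rw [← h]
  exact (norm_inner_le_norm _ _).trans (mul_le_one₀ (hn 1) (norm_nonneg _) (hn 0))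

/-- The vectors are only assumed to have norm at most one, because f(1) may be smaller than one. -/
theorem norm_sub_inner_smul_le {H : Type*} [NormedAddCommGroup H] [InnerProductSpace ℂ H]
    {x y : H} (hx : ‖x‖ ≤ 1) (hy : ‖y‖ ≤ 1) :
    ‖y - inner ℂ x y • x‖ ≤ √(1 - ‖inner ℂ x y‖ ^ 2) := by
  apply Real.le_sqrt_of_sq_le
  rw [norm_sub_sq (𝕜 := ℂ), inner_smul_right, inner_mul_symm_re_eq_norm, norm_smul,
    norm_mul, norm_inner_symm y x]
  have h1 : ‖y‖ ^ 2 ≤ 1 := pow_le_one₀ (norm_nonneg _) hy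
  have h2 : ‖x‖ ^ 2 ≤ 1 := pow_le_one₀ (norm_nonneg _) hx
  nlinarith [sq_nonneg ‖inner ℂ x y‖]

/-- If `f` is nearly of modulus one at `g` and at `h`, it is nearly one at their commutator. -/
theorem IsPosDefFun.norm_commutator_sub_le {f : G → ℂ} (hf : IsPosDefFun f) (h1 : ‖f 1‖ ≤ 1)
    (g h : G) :
    ‖f (g⁻¹ * h⁻¹ * g * h) - f 1‖ ≤ 2 * (√(1 - ‖f g‖ ^ 2) + √(1 - ‖f h‖ ^ 2)) := by
  -- The vectors of gh and hg have inner product f((hg)⁻¹gh), the value at the commutator.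
  obtain ⟨v, hv⟩ := hf.exists_gram ![1, g, h, g * h, h * g]
  have hn : ∀ i, ‖v i‖ ≤ 1 := fun i => by
    have h := hv i i
    rw [inv_mul_cancel, inner_self_eq_norm_sq_to_K] at h
    rw [← h, norm_pow] at h1
    simpa using h1
  have e01 : inner ℂ (v 0) (v 1) = (starRingEnd ℂ) (f g) := by
    rw [← inner_conj_symm, hv]; simp
  have e02 : inner ℂ (v 0) (v 2) = (starRingEnd ℂ) (f h) := by
    rw [← inner_conj_symm, hv]; simp
  have e13 : inner ℂ (v 1) (v 3) = (starRingEnd ℂ) (f h) := by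
    rw [← inner_conj_symm, hv]; simp
  have e24 : inner ℂ (v 2) (v 4) = (starRingEnd ℂ) (f g) := by
    rw [← inner_conj_symm, hv]; simp
  have e34 : inner ℂ (v 3) (v 4) = f (g⁻¹ * h⁻¹ * g * h) := by
    rw [hv]; simp [mul_assoc]
  have e33 : inner ℂ (v 3) (v 3) = f 1 := by
    rw [hv]; simp
  have n01 := norm_sub_inner_smul_le (hn 0) (hn 1)
  have n02 := norm_sub_inner_smul_le (hn 0) (hn 2)
  have n13 := norm_sub_inner_smul_le (hn 1) (hn 3)
  have n24 := norm_sub_inner_smul_le (hn 2) (hn 4)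
  rw [e01, RCLike.norm_conj] at n01
  rw [e02, RCLike.norm_conj] at n02
  rw [e13, RCLike.norm_conj] at n13
  rw [e24, RCLike.norm_conj] at n24
  have hfg : ‖(starRingEnd ℂ) (f g)‖ ≤ 1 := by rw [RCLike.norm_conj]; exact hf.norm_le h1 g
  have hfh : ‖(starRingEnd ℂ) (f h)‖ ≤ 1 := by rw [RCLike.norm_conj]; exact hf.norm_le h1 h
  set a := (starRingEnd ℂ) (f g)
  set b := (starRingEnd ℂ) (f h)
  -- The chain is v(hg) ≈ a v(h) ≈ ab v(1) ≈ b v(g) ≈ v(gh); both ways round, the same scalar ab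
  -- appears.
  have e : v 4 - v 3 = (v 4 - a • v 2) + a • (v 2 - b • v 0) - b • (v 1 - a • v 0)
      - (v 3 - b • v 1) := by
    simp only [smul_sub, smul_smul, mul_comm b a]; abel
  have hd : ‖v 4 - v 3‖ ≤ 2 * (√(1 - ‖f g‖ ^ 2) + √(1 - ‖f h‖ ^ 2)) := by
    rw [e]
    refine (norm_sub_le _ _).trans ?_
    have t1 := norm_sub_le ((v 4 - a • v 2) + a • (v 2 - b • v 0)) (b • (v 1 - a • v 0))
    have t2 := norm_add_le (v 4 - a • v 2) (a • (v 2 - b • v 0))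
    have t3 : ‖a • (v 2 - b • v 0)‖ ≤ ‖v 2 - b • v 0‖ := by
      rw [norm_smul]; exact mul_le_of_le_one_left (norm_nonneg _) hfg
    have t4 : ‖b • (v 1 - a • v 0)‖ ≤ ‖v 1 - a • v 0‖ := by
      rw [norm_smul]; exact mul_le_of_le_one_left (norm_nonneg _) hfh
    linarith
  rw [← e34, ← e33, ← inner_sub_right]
  exact (norm_inner_le_norm _ _).trans ((mul_le_of_le_one_left (norm_nonneg _) (hn 3)).trans hd)

end PositiveDefinite

/-! ### From covariant channels to characteristic functions -/

section Covariant

variable {G : Type v} [Group G]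

theorem System.U_mul_apply (S : System.{u, v} G) (g k : G) (x : S.carrier) :
    S.U (g * k) x = S.U g (S.U k x) := by
  rw [map_mul]; rfl

/-- The characteristic function `g ↦ ⟨ψ|U(g)|ψ⟩` of a vector. -/
noncomputable def charFun (S : System.{u, v} G) (ψ : S.carrier) (g : G) : ℂ :=
  inner ℂ ψ (S.U g ψ)

/-- If a covariant channel takes a pure state close to a pure state, the characteristic function
of the first is nearly a multiple of that of the second by a positive definite function. -/
theorem CovariantlyConvertible.exists_isPosDefFun {S : System.{u, v} G} {T : System.{w, v} G}
    {Ψ : S.carrier} (hΨ : ‖Ψ‖ = 1) {Φ : T.carrier} (hΦ : ‖Φ‖ = 1) {σ : DensityOp T.carrier}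
    (h : CovariantlyConvertible S T (pureState Ψ hΨ) σ) :
    ∃ f : G → ℂ, IsPosDefFun f ∧ f 1 = inner ℂ Φ (σ.op Φ) ∧
      ∀ (g : G) (δ : ℝ), 0 < δ → 1 - δ ^ 2 ≤ (inner ℂ Φ (σ.op Φ)).re →
        ‖charFun S Ψ g - charFun T Φ g * f g‖ ≤ 2 * δ := by
  obtain ⟨E, hE, hEσ⟩ := h
  have hσ : E.map (ketBra Ψ Ψ) = σ.toTraceClass := hEσ
  have hcov : ∀ g k : G, E.map (ketBra (S.U g Ψ) (S.U k Ψ))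
      = conjTC (T.U k) (E.map (ketBra (S.U (k⁻¹ * g) Ψ) Ψ)) := fun g k => by
    rw [← hE, conjTC_ketBra, ← System.U_mul_apply, mul_inv_cancel_left]
  -- This is the matrix element left over when the off-diagonal block is compressed to V(g)Φ and Φ.
  let f : G → ℂ := fun g =>
    inner ℂ (T.U g Φ) ((E.map (ketBra (S.U g Ψ) Ψ) : T.carrier →L[ℂ] T.carrier) Φ)
  have hf : ∀ g k : G, inner ℂ (T.U g Φ)
      ((E.map (ketBra (S.U g Ψ) (S.U k Ψ)) : T.carrier →L[ℂ] T.carrier) (T.U k Φ))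
      = f (k⁻¹ * g) := fun g k => by
    rw [hcov]
    change inner ℂ _ (conj (T.U k) _ _) = _
    rw [conj_apply, LinearIsometryEquiv.symm_apply_apply]
    conv_lhs => rw [← mul_inv_cancel_left k g, T.U_mul_apply k (k⁻¹ * g), LinearIsometryEquiv.inner_map_map]
    rw [mul_inv_cancel_left]
  have hU1 : ∀ x : T.carrier, T.U 1 x = x := fun x => by rw [map_one]; rfl
  have hV1 : ∀ x : S.carrier, S.U 1 x = x := fun x => by rw [map_one]; rfl
  refine ⟨f, fun n g x => ?_, ?_, fun g δ hδ hδσ => ?_⟩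
  · have h := E.completelyPositive n _ (blockPositive_ketBra fun i => S.U (g i) Ψ)
      fun i => x i • T.U (g i) Φ
    convert h using 1
    refine Finset.sum_congr rfl fun i _ => Finset.sum_congr rfl fun j _ => ?_
    rw [inner_smul_left, map_smul, inner_smul_right, hf]
    ring
  · change inner ℂ (T.U 1 Φ) ((E.map (ketBra (S.U 1 Ψ) Ψ) : T.carrier →L[ℂ] T.carrier) Φ) = _
    rw [hU1, hV1, hσ]
    rfl
  -- By covariance both diagonal blocks have the same overlap with their targets V(g)Φ and Φ. By
  -- trace preservation the off-diagonal trace is ⟨Ψ|U(g)Ψ⟩.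
  · have hpos := E.completelyPositive 2 _ (blockPositive_ketBra ![S.U g Ψ, Ψ])
    have ht : ∀ x : S.carrier, ‖x‖ = 1 → tr (E.map (ketBra x x) : T.carrier →L[ℂ] T.carrier) = 1 :=
      fun x hx => by
        rw [E.tracePreserving, tr_ketBra, inner_self_eq_norm_sq_to_K, hx]; simp
    have hb := norm_tr_sub_le_of_blockPositive hpos (ht _ (by simp [hΨ])) (ht _ hΨ)
      (p := T.U g Φ) (q := Φ) (by simp [hΦ]) hΦ hδ
      (by
        change _ ≤ (inner ℂ (T.U g Φ) ((E.map (ketBra (S.U g Ψ) (S.U g Ψ)) :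
          T.carrier →L[ℂ] T.carrier) (T.U g Φ))).re
        rw [hf, inv_mul_cancel]
        change _ ≤ (inner ℂ (T.U 1 Φ)
          ((E.map (ketBra (S.U 1 Ψ) Ψ) : T.carrier →L[ℂ] T.carrier) Φ)).re
        rw [hU1, hV1, hσ]
        exact hδσ)
      (by
        change _ ≤ (inner ℂ Φ ((E.map (ketBra Ψ Ψ) : T.carrier →L[ℂ] T.carrier) Φ)).re
        rw [hσ]
        exact hδσ)
    simp only [Matrix.cons_val_zero, Matrix.cons_val_one] at hb
    rw [E.tracePreserving, tr_ketBra] at hb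
    exact hb

theorem charFun_tensor (S T : System.{u, v} G) (x : S.carrier) (y : T.carrier) (g : G) :
    charFun (S.tensor T) ((x ⊗ₜ[ℂ] y : S.carrier ⊗[ℂ] T.carrier) :
      UniformSpace.Completion (S.carrier ⊗[ℂ] T.carrier)) g = charFun S x g * charFun T y g := by
  change inner ℂ ((x ⊗ₜ[ℂ] y : S.carrier ⊗[ℂ] T.carrier) :
      UniformSpace.Completion (S.carrier ⊗[ℂ] T.carrier))
      (completionIso (TensorProduct.congrIsometry (S.U g) (T.U g))
        ((x ⊗ₜ[ℂ] y : S.carrier ⊗[ℂ] T.carrier) :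
          UniformSpace.Completion (S.carrier ⊗[ℂ] T.carrier))) = _
  rw [completionIso_coe, UniformSpace.Completion.inner_coe]
  exact TensorProduct.inner_tmul ℂ x (S.U g x) y (T.U g y)

theorem charFun_powerVec (S : System.{u, v} G) (ψ : S.carrier) (n : ℕ) (g : G) :
    charFun (S.power n) (S.powerVec ψ n) g = charFun S ψ g ^ n := by
  induction n with
  | zero =>
    change inner ℂ (EuclideanSpace.single PUnit.unit 1 : EuclideanSpace ℂ PUnit.{u + 1})
      (EuclideanSpace.single PUnit.unit 1 : EuclideanSpace ℂ PUnit.{u + 1}) = _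
    simp
  | succ n ih =>
    rw [pow_succ, ← ih]
    exact charFun_tensor (S.power n) S (S.powerVec ψ n) ψ g

/-- After this, channels are no longer needed. The error does not depend on g, so g may be chosen to
vary with N. -/
theorem AsymptoticallyConvertible.exists_isPosDefFun {S : System.{u, v} G} {T : System.{w, v} G}
    {ψ : S.carrier} {hψ : ‖ψ‖ = 1} {φ : T.carrier} {hφ : ‖φ‖ = 1} {R : ℝ}
    (h : AsymptoticallyConvertible S T ψ hψ φ hφ R) :
    ∃ (f : ℕ → G → ℂ) (δ : ℕ → ℝ), (∀ N, IsPosDefFun (f N)) ∧ (∀ N, ‖f N 1‖ ≤ 1) ∧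
      Tendsto (fun N => f N 1) atTop (𝓝 1) ∧ Tendsto δ atTop (𝓝 0) ∧
      ∀ (N : ℕ) (g : G), ‖charFun S ψ g ^ N - charFun T φ g ^ ⌊(N : ℝ) * R⌋₊ * f N g‖ ≤ δ N := by
  obtain ⟨σ, hσ, hlim⟩ := h
  choose f hf hf1 hfδ using fun N => (hσ N).exists_isPosDefFun _
    (T.norm_powerVec hφ ⌊(N : ℝ) * R⌋₊)
  set r : ℕ → ℝ := fun N => (inner ℂ (T.powerVec φ ⌊(N : ℝ) * R⌋₊)
    ((σ N).op (T.powerVec φ ⌊(N : ℝ) * R⌋₊))).re with hr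
  have hr1 : ∀ N, r N ≤ 1 := fun N => (σ N).re_inner_le_one (T.norm_powerVec hφ _)
  have hr0 : ∀ N, 0 ≤ r N := fun N => (Complex.nonneg_iff.1 ((σ N).inner_nonneg _)).1
  have hfr : ∀ N, f N 1 = (r N : ℂ) := fun N => (hf1 N).trans ((σ N).inner_eq_re _)
  have hrlim : Tendsto r atTop (𝓝 1) := by
    have h2 := hlim.pow 2
    rw [one_pow] at h2
    refine h2.congr fun N => ?_
    rw [System.powerState, fid_pureState]
    exact Real.sq_sqrt (hr0 N)
  -- The summand 1/(N+1) keeps the parameter positive when the overlap is exactly one.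
  refine ⟨f, fun N => 2 * (√(1 - r N) + 1 / ((N : ℝ) + 1)), hf, fun N => ?_, ?_, ?_,
    fun N g => ?_⟩
  · rw [hfr, Complex.norm_real, Real.norm_of_nonneg (hr0 N)]; exact hr1 N
  · simp only [hfr]
    exact_mod_cast (Complex.continuous_ofReal.tendsto 1).comp hrlim
  · have h1 := (Real.continuous_sqrt.tendsto _).comp (hrlim.const_sub 1)
    have h2 := (h1.add tendsto_one_div_add_atTop_nhds_zero_nat).const_mul (2 : ℝ)
    simpa using h2
  · rw [← charFun_powerVec, ← charFun_powerVec]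
    have hN : (0 : ℝ) < 1 / ((N : ℝ) + 1) := by positivity
    refine hfδ N g _ (add_pos_of_nonneg_of_pos (Real.sqrt_nonneg _) hN) ?_
    have h3 := Real.sq_sqrt (sub_nonneg.2 (hr1 N))
    have h4 := Real.sqrt_nonneg (1 - r N)
    change _ ≤ r N
    nlinarith

end Covariant

/-! ### Gaussian and exponential limits of powers -/

section Limits

/-- Since log(1+z) = z + O(z²), the error k·O(z²) = (kz)·O(z) vanishes. -/
theorem tendsto_one_add_pow_exp {k : ℕ → ℕ} {z : ℕ → ℂ} {t : ℂ} (hz : Tendsto z atTop (𝓝 0))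
    (ht : Tendsto (fun N => (k N : ℂ) * z N) atTop (𝓝 t)) :
    Tendsto (fun N => (1 + z N) ^ k N) atTop (𝓝 (Complex.exp t)) := by
  have hn : Tendsto (fun N => ‖z N‖) atTop (𝓝 0) := by simpa using hz.norm
  have hlt : ∀ᶠ N in atTop, ‖z N‖ < 1 := hn.eventually_lt_const one_pos
  have hlog : Tendsto (fun N => (k N : ℂ) * (Complex.log (1 + z N) - z N)) atTop (𝓝 0) := by
    have hb : Tendsto (fun N => ‖(k N : ℂ) * z N‖ * (‖z N‖ * (1 - ‖z N‖)⁻¹ / 2)) atTop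
        (𝓝 (‖t‖ * (0 * (1 - 0)⁻¹ / 2))) :=
      ht.norm.mul ((hn.mul ((hn.const_sub 1).inv₀ (by norm_num))).div_const 2)
    rw [zero_mul, zero_div, mul_zero] at hb
    refine squeeze_zero_norm' ?_ hb
    filter_upwards [hlt] with N hN
    rw [norm_mul, norm_mul]
    have := Complex.norm_log_one_add_sub_self_le hN
    calc _ ≤ ‖(k N : ℂ)‖ * (‖z N‖ ^ 2 * (1 - ‖z N‖)⁻¹ / 2) := by gcongr
      _ = _ := by ring
  have hsum := ht.add hlog
  rw [add_zero] at hsum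
  refine ((Complex.continuous_exp.tendsto t).comp hsum).congr' ?_
  filter_upwards [hlt] with N hN
  have hne : 1 + z N ≠ 0 := fun h0 => by
    rw [← neg_eq_of_add_eq_zero_right h0, norm_neg, norm_one] at hN
    exact lt_irrefl _ hN
  rw [Function.comp_apply, ← mul_add, add_sub_cancel, Complex.exp_nat_mul, Complex.exp_log hne]

theorem tendsto_one_sub_pow_exp {k : ℕ → ℕ} {z : ℕ → ℝ} {t : ℝ} (hz : Tendsto z atTop (𝓝 0))
    (ht : Tendsto (fun N => (k N : ℝ) * z N) atTop (𝓝 t)) :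
    Tendsto (fun N => (1 - z N) ^ k N) atTop (𝓝 (Real.exp (-t))) := by
  have h := tendsto_one_add_pow_exp (k := k) (z := fun N => ((-z N : ℝ) : ℂ)) (t := ((-t : ℝ) : ℂ))
    (by
      have := (Complex.continuous_ofReal.tendsto _).comp hz.neg
      rwa [neg_zero, Complex.ofReal_zero] at this)
    (by
      have := (Complex.continuous_ofReal.tendsto _).comp ht.neg
      refine this.congr fun N => ?_
      rw [Function.comp_apply]; push_cast; ring)
  have h2 := (Complex.continuous_re.tendsto _).comp h
  rw [← Complex.ofReal_exp, Complex.ofReal_re] at h2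
  refine h2.congr fun N => ?_
  rw [Function.comp_apply, ← Complex.ofReal_one, ← Complex.ofReal_add, ← Complex.ofReal_pow,
    Complex.ofReal_re, sub_eq_add_neg]

variable {H : Type*} [NormedAddCommGroup H] [InnerProductSpace ℂ H]

/-- The squared norm of the component of `w` orthogonal to the unit vector `ψ`. -/
noncomputable def orthNormSq (ψ w : H) : ℝ := ‖w‖ ^ 2 - ‖inner ℂ ψ w‖ ^ 2

theorem norm_sub_inner_smul_sq {ψ : H} (hψ : ‖ψ‖ = 1) (u : H) :
    ‖u - inner ℂ ψ u • ψ‖ ^ 2 = orthNormSq ψ u := by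
  rw [norm_sub_sq (𝕜 := ℂ), inner_smul_right, inner_mul_symm_re_eq_norm, norm_smul,
    norm_mul, norm_inner_symm u ψ, hψ, orthNormSq]
  ring

theorem tendsto_zero_of_tendsto_smul {c : ℕ → ℝ} (hc : Tendsto c atTop atTop)
    {V : Type*} [NormedAddCommGroup V] [NormedSpace ℝ V] {x : ℕ → V} {w : V}
    (h : Tendsto (fun N => c N • x N) atTop (𝓝 w)) : Tendsto x atTop (𝓝 0) := by
  have h2 := (tendsto_inv_atTop_zero.comp hc).smul h
  rw [zero_smul] at h2
  refine h2.congr' ?_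
  filter_upwards [hc.eventually_gt_atTop 0] with N hN
  rw [Function.comp_apply, smul_smul, inv_mul_cancel₀ hN.ne', one_smul]

/-- For unit vectors, |⟨ψ|u⟩|² is 1 minus the squared norm of the part of u orthogonal to ψ.
Subtracting ψ does not change that part, so at speed 1/√N it is governed by w. -/
theorem tendsto_norm_inner_pow_exp [NormedSpace ℝ H] [IsScalarTower ℝ ℂ H]
    {ψ : H} (hψ : ‖ψ‖ = 1) {u : ℕ → H} (hu : ∀ N, ‖u N‖ = 1)
    {w : H} {k : ℕ → ℕ} {r : ℝ} (hk : Tendsto (fun N => (k N : ℝ) / N) atTop (𝓝 r))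
    (h : Tendsto (fun N : ℕ => √(N : ℝ) • (u N - ψ)) atTop (𝓝 w)) :
    Tendsto (fun N => (‖inner ℂ ψ (u N)‖ ^ 2) ^ k N) atTop
      (𝓝 (Real.exp (-(r * orthNormSq ψ w)))) := by
  have hc : Tendsto (fun N : ℕ => √(N : ℝ)) atTop atTop :=
    Real.tendsto_sqrt_atTop.comp tendsto_natCast_atTop_atTop
  have hpp : inner ℂ ψ ψ = (1 : ℂ) := by
    rw [inner_self_eq_norm_sq_to_K, hψ]; simp
  have e : ∀ N, orthNormSq ψ (u N) = 1 - ‖inner ℂ ψ (u N)‖ ^ 2 := fun N => by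
    rw [orthNormSq, hu, one_pow]
  have hq : Tendsto (fun N : ℕ => (N : ℝ) * orthNormSq ψ (u N)) atTop (𝓝 (orthNormSq ψ w)) := by
    have h1 : Tendsto (fun N : ℕ => √(N : ℝ) • (u N - ψ)
        - inner ℂ ψ (√(N : ℝ) • (u N - ψ)) • ψ) atTop (𝓝 (w - inner ℂ ψ w • ψ)) :=
      h.sub ((Tendsto.inner tendsto_const_nhds h).smul tendsto_const_nhds)
    have h2 := h1.norm.pow 2
    rw [norm_sub_inner_smul_sq hψ] at h2
    refine h2.congr fun N => ?_
    have e3 : √(N : ℝ) • (u N - ψ) - inner ℂ ψ (√(N : ℝ) • (u N - ψ)) • ψ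
        = (√(N : ℝ) : ℂ) • (u N - inner ℂ ψ (u N) • ψ) := by
      rw [← algebraMap_smul ℂ (√(N : ℝ)) (u N - ψ), Complex.coe_algebraMap, inner_smul_right,
        inner_sub_right, hpp]
      match_scalars <;> ring
    rw [e3, norm_smul, mul_pow, norm_sub_inner_smul_sq hψ, Complex.norm_real,
      Real.norm_of_nonneg (Real.sqrt_nonneg _), Real.sq_sqrt (Nat.cast_nonneg _)]
  have hz := tendsto_zero_of_tendsto_smul tendsto_natCast_atTop_atTop (x := fun N =>
    orthNormSq ψ (u N)) hq
  have ht : Tendsto (fun N => (k N : ℝ) * orthNormSq ψ (u N)) atTop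
      (𝓝 (r * orthNormSq ψ w)) := by
    refine (hk.mul hq).congr' ?_
    filter_upwards [eventually_gt_atTop 0] with N hN
    have : (N : ℝ) ≠ 0 := by positivity
    field_simp
  refine (tendsto_one_sub_pow_exp hz ht).congr fun N => ?_
  rw [e, sub_sub_cancel]

/-- At speed 1/N the first moment survives, together with its phase. -/
theorem tendsto_inner_pow_exp [NormedSpace ℝ H] [IsScalarTower ℝ ℂ H]
    {ψ : H} (hψ : ‖ψ‖ = 1) {u : ℕ → H}
    {w : H} {k : ℕ → ℕ} {r : ℝ} (hk : Tendsto (fun N => (k N : ℝ) / N) atTop (𝓝 r))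
    (h : Tendsto (fun N : ℕ => (N : ℝ) • (u N - ψ)) atTop (𝓝 w)) :
    Tendsto (fun N => inner ℂ ψ (u N) ^ k N) atTop (𝓝 (Complex.exp (r * inner ℂ ψ w))) := by
  have hpp : inner ℂ ψ ψ = (1 : ℂ) := by
    rw [inner_self_eq_norm_sq_to_K, hψ]; simp
  have e : ∀ N, inner ℂ ψ (u N) = 1 + inner ℂ ψ (u N - ψ) := fun N => by
    rw [inner_sub_right, hpp]; ring
  have h0 := tendsto_zero_of_tendsto_smul tendsto_natCast_atTop_atTop h
  have hz : Tendsto (fun N => inner ℂ ψ (u N - ψ)) atTop (𝓝 0) := by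
    have := Tendsto.inner (𝕜 := ℂ) (tendsto_const_nhds (x := ψ)) h0
    rwa [inner_zero_right] at this
  have ht : Tendsto (fun N => (k N : ℂ) * inner ℂ ψ (u N - ψ)) atTop (𝓝 (r * inner ℂ ψ w)) := by
    have h1 := ((Complex.continuous_ofReal.tendsto _).comp hk).mul
      (Tendsto.inner (𝕜 := ℂ) (tendsto_const_nhds (x := ψ)) h)
    refine h1.congr' ?_
    filter_upwards [eventually_gt_atTop 0] with N hN
    have : (N : ℂ) ≠ 0 := by exact_mod_cast hN.ne'
    rw [← algebraMap_smul ℂ (N : ℝ) (u N - ψ), Complex.coe_algebraMap, inner_smul_right]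
    simp only [Function.comp_apply]
    push_cast
    field_simp
  refine (tendsto_one_add_pow_exp hz ht).congr fun N => ?_
  rw [← e]

theorem tendsto_floor_mul_div {R : ℝ} (hR : 0 < R) :
    Tendsto (fun N : ℕ => (⌊(N : ℝ) * R⌋₊ : ℝ) / N) atTop (𝓝 R) := by
  have h := (tendsto_nat_floor_mul_div_atTop hR.le).comp (tendsto_natCast_atTop_atTop (R := ℝ))
  refine h.congr fun N => ?_
  rw [Function.comp_apply, mul_comm]

theorem tendsto_natCast_div_self :
    Tendsto (fun N : ℕ => (N : ℝ) / N) atTop (𝓝 1) := by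
  refine tendsto_const_nhds.congr' ?_
  filter_upwards [eventually_gt_atTop 0] with N hN
  have : (N : ℝ) ≠ 0 := by positivity
  rw [div_self this]

end Limits

/-! ### Symmetries, second moments and commutators -/

section Consequences

variable {G : Type v} [Group G] {S : System.{u, v} G} {T : System.{w, v} G}
  {ψ : S.carrier} {hψ : ‖ψ‖ = 1} {φ : T.carrier} {hφ : ‖φ‖ = 1} {R : ℝ}

include hψ in
-- This is the equality case of Cauchy-Schwarz.
theorem mem_sym_pureState_iff (g : G) :
    g ∈ sym S (pureState ψ hψ) ↔ ‖charFun S ψ g‖ = 1 := by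
  have hc : conj (S.U g) (InnerProductSpace.rankOne ℂ ψ ψ)
      = InnerProductSpace.rankOne ℂ (S.U g ψ) (S.U g ψ) :=
    congrArg Subtype.val (conjTC_ketBra (S.U g) ψ ψ)
  have hn : ‖S.U g ψ‖ = 1 := by rw [LinearIsometryEquiv.norm_map, hψ]
  change conj (S.U g) (InnerProductSpace.rankOne ℂ ψ ψ) = InnerProductSpace.rankOne ℂ ψ ψ ↔ _
  rw [hc]
  constructor
  · intro h
    have h2 := congrArg (fun L : S.carrier →L[ℂ] S.carrier => ‖L (S.U g ψ)‖) h
    simp only [InnerProductSpace.rankOne_apply, norm_smul, hn, hψ, mul_one,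
      inner_self_eq_norm_sq_to_K] at h2
    rw [charFun, ← h2]
    simp
  · intro h
    have h2 := norm_sub_inner_smul_sq hψ (S.U g ψ)
    rw [orthNormSq, hn, ← charFun, h, sub_self, sq_eq_zero_iff, norm_eq_zero, sub_eq_zero] at h2
    ext z
    rw [InnerProductSpace.rankOne_apply, InnerProductSpace.rankOne_apply, h2, inner_smul_left,
      smul_smul, mul_right_comm, RCLike.conj_mul, h]
    simp

include hψ in
theorem norm_charFun_le_one (g : G) : ‖charFun S ψ g‖ ≤ 1 := by
  refine (norm_inner_le_norm _ _).trans ?_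
  rw [LinearIsometryEquiv.norm_map, hψ, mul_one]

theorem AsymptoticallyConvertible.sym_subset
    (h : AsymptoticallyConvertible S T ψ hψ φ hφ R) (hR : 0 < R) :
    sym S (pureState ψ hψ) ⊆ sym T (pureState φ hφ) := by
  intro g hg
  rw [mem_sym_pureState_iff] at hg ⊢
  obtain ⟨f, δ, hf, hf1, -, hδ, hfδ⟩ := h.exists_isPosDefFun
  refine le_antisymm (norm_charFun_le_one (hψ := hφ) g) ?_
  have hle : ∀ᶠ N in atTop, (1 : ℝ) - δ N ≤ ‖charFun T φ g‖ := by
    have hM : Tendsto (fun N : ℕ => ⌊(N : ℝ) * R⌋₊) atTop atTop :=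
      tendsto_nat_floor_atTop.comp (tendsto_natCast_atTop_atTop.atTop_mul_const hR)
    -- A positive exponent is needed to bound the power by its base.
    filter_upwards [hM.eventually_ge_atTop 1] with N hN
    have h1 := (norm_sub_norm_le _ _).trans (hfδ N g)
    rw [norm_pow, hg, one_pow, norm_mul, norm_pow] at h1
    have h2 : ‖charFun T φ g‖ ^ ⌊(N : ℝ) * R⌋₊ ≤ ‖charFun T φ g‖ :=
      pow_le_of_le_one (norm_nonneg _) (norm_charFun_le_one (hψ := hφ) g)
        (Nat.one_le_iff_ne_zero.1 hN)
    have h3 := (hf N).norm_le (hf1 N) g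
    have h4 : 0 ≤ ‖charFun T φ g‖ ^ ⌊(N : ℝ) * R⌋₊ := by positivity
    nlinarith
  have hl := hδ.const_sub 1
  rw [sub_zero] at hl
  exact le_of_tendsto hl hle

theorem tendsto_norm_charFun_pow {g : ℕ → G} {w : S.carrier} {k : ℕ → ℕ} {r : ℝ} (hψ : ‖ψ‖ = 1)
    (hk : Tendsto (fun N => (k N : ℝ) / N) atTop (𝓝 r))
    (hw : Tendsto (fun N : ℕ => √(N : ℝ) • (S.U (g N) ψ - ψ)) atTop (𝓝 w)) :
    Tendsto (fun N => ‖charFun S ψ (g N)‖ ^ k N) atTop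
      (𝓝 (√(Real.exp (-(r * orthNormSq ψ w))))) := by
  have h := tendsto_norm_inner_pow_exp hψ (u := fun N => S.U (g N) ψ)
    (fun N => by rw [LinearIsometryEquiv.norm_map, hψ]) hk hw
  refine ((Real.continuous_sqrt.tendsto _).comp h).congr fun N => ?_
  rw [Function.comp_apply, pow_right_comm, Real.sqrt_sq (by positivity), charFun]

/-- Because |f_N| ≤ 1, |χ_ψ|^N ≤ |χ_φ|^M + o(1); the Gaussian limits compare the exponents. -/
theorem AsymptoticallyConvertible.mul_orthNormSq_le
    (h : AsymptoticallyConvertible S T ψ hψ φ hφ R) (hR : 0 < R) {g : ℕ → G}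
    {w : S.carrier} {w' : T.carrier}
    (hw : Tendsto (fun N : ℕ => √(N : ℝ) • (S.U (g N) ψ - ψ)) atTop (𝓝 w))
    (hw' : Tendsto (fun N : ℕ => √(N : ℝ) • (T.U (g N) φ - φ)) atTop (𝓝 w')) :
    R * orthNormSq φ w' ≤ orthNormSq ψ w := by
  obtain ⟨f, δ, hf, hf1, -, hδ, hfδ⟩ := h.exists_isPosDefFun
  have ha := tendsto_norm_charFun_pow hψ tendsto_natCast_div_self hw
  have hb := (tendsto_norm_charFun_pow hφ (tendsto_floor_mul_div hR) hw').add hδ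
  have hle := le_of_tendsto_of_tendsto' ha hb fun N => by
    have h1 := (norm_sub_norm_le _ _).trans (hfδ N (g N))
    rw [norm_pow, norm_mul, norm_pow] at h1
    have h2 : ‖charFun T φ (g N)‖ ^ ⌊(N : ℝ) * R⌋₊ * ‖f N (g N)‖
        ≤ ‖charFun T φ (g N)‖ ^ ⌊(N : ℝ) * R⌋₊ :=
      mul_le_of_le_one_right (by positivity) ((hf N).norm_le (hf1 N) (g N))
    linarith
  rw [one_mul, add_zero, Real.sqrt_le_sqrt_iff (Real.exp_pos _).le, Real.exp_le_exp] at hle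
  linarith

/-- Convertibility with matching second moments forces the characteristic functions to agree
asymptotically on commutators. -/
theorem AsymptoticallyConvertible.exp_inner_eq
    (h : AsymptoticallyConvertible S T ψ hψ φ hφ R) (hR : 0 < R) {g k : ℕ → G}
    {w z d : S.carrier} {w' z' d' : T.carrier}
    (hw : Tendsto (fun N : ℕ => √(N : ℝ) • (S.U (g N) ψ - ψ)) atTop (𝓝 w))
    (hw' : Tendsto (fun N : ℕ => √(N : ℝ) • (T.U (g N) φ - φ)) atTop (𝓝 w'))
    (hww : orthNormSq ψ w = R * orthNormSq φ w')
    (hz : Tendsto (fun N : ℕ => √(N : ℝ) • (S.U (k N) ψ - ψ)) atTop (𝓝 z))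
    (hz' : Tendsto (fun N : ℕ => √(N : ℝ) • (T.U (k N) φ - φ)) atTop (𝓝 z'))
    (hzz : orthNormSq ψ z = R * orthNormSq φ z')
    (hd : Tendsto (fun N : ℕ => (N : ℝ) • (S.U ((g N)⁻¹ * (k N)⁻¹ * g N * k N) ψ - ψ)) atTop (𝓝 d))
    (hd' : Tendsto (fun N : ℕ => (N : ℝ) • (T.U ((g N)⁻¹ * (k N)⁻¹ * g N * k N) φ - φ)) atTop
      (𝓝 d')) :
    Complex.exp (inner ℂ ψ d) = Complex.exp (R * inner ℂ φ d') := by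
  obtain ⟨f, δ, hf, hf1, hf1lim, hδ, hfδ⟩ := h.exists_isPosDefFun
  -- With matching moments both powers tend to the same nonzero limit, so their ratio, which is
  -- |f_N| up to o(1), tends to one.
  have hmod : ∀ {g : ℕ → G} {w : S.carrier} {w' : T.carrier},
      Tendsto (fun N : ℕ => √(N : ℝ) • (S.U (g N) ψ - ψ)) atTop (𝓝 w) →
      Tendsto (fun N : ℕ => √(N : ℝ) • (T.U (g N) φ - φ)) atTop (𝓝 w') →
      orthNormSq ψ w = R * orthNormSq φ w' →
      Tendsto (fun N => √(1 - ‖f N (g N)‖ ^ 2)) atTop (𝓝 0) := by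
    intro g w w' hw hw' hww
    have ha := tendsto_norm_charFun_pow hψ tendsto_natCast_div_self hw
    have hb := tendsto_norm_charFun_pow hφ (tendsto_floor_mul_div hR) hw'
    rw [one_mul, hww] at ha
    have hs : √(Real.exp (-(R * orthNormSq φ w'))) ≠ 0 := (Real.sqrt_pos.2 (Real.exp_pos _)).ne'
    have hdiff : Tendsto (fun N => ‖charFun S ψ (g N)‖ ^ N
        - ‖charFun T φ (g N)‖ ^ ⌊(N : ℝ) * R⌋₊ * ‖f N (g N)‖) atTop (𝓝 0) :=
      squeeze_zero_norm (fun N => by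
        have h1 := (abs_norm_sub_norm_le _ _).trans (hfδ N (g N))
        rwa [norm_pow, norm_mul, norm_pow] at h1) hδ
    have hf : Tendsto (fun N => ‖f N (g N)‖) atTop (𝓝 1) := by
      have h1 := (ha.sub hdiff).div hb hs
      rw [sub_zero, div_self hs] at h1
      refine h1.congr' ?_
      filter_upwards [hb.eventually_ne hs] with N hN
      simp only [Pi.div_apply, sub_sub_cancel]
      rw [mul_div_cancel_left₀ _ hN]
    have h2 := (Real.continuous_sqrt.tendsto _).comp ((hf.pow 2).const_sub 1)
    rw [one_pow, sub_self, Real.sqrt_zero] at h2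
    exact h2
  have hfc : Tendsto (fun N => f N ((g N)⁻¹ * (k N)⁻¹ * g N * k N)) atTop (𝓝 1) := by
    have h1 : Tendsto (fun N => f N ((g N)⁻¹ * (k N)⁻¹ * g N * k N) - f N 1) atTop (𝓝 0) := by
      refine squeeze_zero_norm (fun N => (hf N).norm_commutator_sub_le (hf1 N) (g N) (k N)) ?_
      have := ((hmod hw hw' hww).add (hmod hz hz' hzz)).const_mul 2
      simpa using this
    simpa using h1.add hf1lim
  have hA := tendsto_inner_pow_exp hψ tendsto_natCast_div_self hd
  have hB := (tendsto_inner_pow_exp hφ (tendsto_floor_mul_div hR) hd').mul hfc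
  have hAB := squeeze_zero_norm (fun N => hfδ N ((g N)⁻¹ * (k N)⁻¹ * g N * k N)) hδ
  have := tendsto_nhds_unique hAB (hA.sub hB)
  rw [mul_one, Complex.ofReal_one, one_mul] at this
  exact (sub_eq_zero.1 this.symm)

end Consequences

/-! ### Second-order expansion of a local group law -/

section LocalGroupLaw

variable {E : Type*} [NormedAddCommGroup E] [NormedSpace ℝ E] {m : E × E → E} {x₀ : E}

theorem eventually_fderiv_inr_eq (hm : ContDiffAt ℝ 2 m (x₀, x₀))
    (h2 : ∀ᶠ x in 𝓝 x₀, m (x₀, x) = x) :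
    ∀ᶠ x in 𝓝 x₀, ∀ u, fderiv ℝ m (x₀, x) (0, u) = u := by
  have hd : ∀ᶠ q in 𝓝 (x₀, x₀), DifferentiableAt ℝ m q :=
    (hm.eventually (by simp)).mono fun q hq => hq.differentiableAt (by simp)
  have hc : Tendsto (fun x => (x₀, x)) (𝓝 x₀) (𝓝 (x₀, x₀)) :=
    (Continuous.prodMk_right x₀).tendsto x₀
  filter_upwards [hc.eventually hd, h2.eventually_nhds] with x hx hx2 u
  have h3 : HasFDerivAt (fun y => m (x₀, y))
      ((fderiv ℝ m (x₀, x)).comp (ContinuousLinearMap.inr ℝ E E)) x :=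
    HasFDerivAt.comp x hx.hasFDerivAt (hasFDerivAt_prodMk_right x₀ x)
  have h4 : HasFDerivAt (fun y => m (x₀, y)) (ContinuousLinearMap.id ℝ E) x :=
    (hasFDerivAt_id x).congr_of_eventuallyEq hx2
  exact congrArg (fun L : E →L[ℝ] E => L u) (h3.unique h4)

theorem hasFDerivAt_fderiv_inl (hm : ContDiffAt ℝ 2 m (x₀, x₀)) (u : E) :
    HasFDerivAt (fun x => fderiv ℝ m (x, x₀) (0, u))
      (((fderiv ℝ (fderiv ℝ m) (x₀, x₀)).comp (ContinuousLinearMap.inl ℝ E E)).flip (0, u)) x₀ := by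
  have hD : HasFDerivAt (fderiv ℝ m) (fderiv ℝ (fderiv ℝ m) (x₀, x₀)) (x₀, x₀) :=
    ((hm.fderiv_right (m := 1) (by norm_num)).differentiableAt (by simp)).hasFDerivAt
  have h3 : HasFDerivAt (fun x => fderiv ℝ m (x, x₀)) _ x₀ :=
    HasFDerivAt.comp x₀ (f := fun x => (x, x₀)) hD (hasFDerivAt_prodMk_left x₀ x₀)
  exact (ContinuousLinearMap.apply ℝ E ((0 : E), u)).hasFDerivAt.comp x₀ h3

/-- Near x₀ the map m(x₀, ·) is the identity, so only mixed second derivatives can matter. -/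
theorem fderiv_fderiv_inr_inr (hm : ContDiffAt ℝ 2 m (x₀, x₀))
    (h2 : ∀ᶠ x in 𝓝 x₀, m (x₀, x) = x) (u u' : E) :
    fderiv ℝ (fderiv ℝ m) (x₀, x₀) (0, u) (0, u') = 0 := by
  have hD : HasFDerivAt (fderiv ℝ m) (fderiv ℝ (fderiv ℝ m) (x₀, x₀)) (x₀, x₀) :=
    ((hm.fderiv_right (m := 1) (by norm_num)).differentiableAt (by simp)).hasFDerivAt
  have h3 : HasFDerivAt (fun x => fderiv ℝ m (x₀, x) (0, u')) _ x₀ :=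
    (ContinuousLinearMap.apply ℝ E ((0 : E), u')).hasFDerivAt.comp x₀
      (HasFDerivAt.comp x₀ hD (hasFDerivAt_prodMk_right x₀ x₀))
  have h4 : HasFDerivAt (fun x => fderiv ℝ m (x₀, x) (0, u')) (0 : E →L[ℝ] E) x₀ :=
    (hasFDerivAt_const u' x₀).congr_of_eventuallyEq
      ((eventually_fderiv_inr_eq hm h2).mono fun x hx => hx u')
  exact congrArg (fun L : E →L[ℝ] E => L u) (h3.unique h4)

/-- The second order expansion of a local group law along two lines. -/
theorem tendsto_inv_sq_smul_localMul (hm : ContDiffAt ℝ 2 m (x₀, x₀))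
    (h1 : ∀ᶠ x in 𝓝 x₀, m (x, x₀) = x) (h2 : ∀ᶠ x in 𝓝 x₀, m (x₀, x) = x)
    (v w : E) {t : ℕ → ℝ} (ht0 : ∀ᶠ N in atTop, 0 < t N) (ht : Tendsto t atTop (𝓝 0)) :
    Tendsto (fun N => (t N ^ 2)⁻¹ • (m (x₀ + t N • v, x₀ + t N • w) - x₀ - t N • v - t N • w))
      atTop (𝓝 (fderiv ℝ (fderiv ℝ m) (x₀, x₀) (v, 0) (0, w))) := by
  set p : E × E := (x₀, x₀) with hp
  set D := fderiv ℝ m with hDdef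
  set D2 := fderiv ℝ D p with hD2def
  have hD : HasFDerivAt D D2 p :=
    ((hm.fderiv_right (m := 1) (by norm_num)).differentiableAt (by simp)).hasFDerivAt
  have hd : ∀ᶠ q in 𝓝 p, DifferentiableAt ℝ m q :=
    (hm.eventually (by simp)).mono fun q hq => hq.differentiableAt (by simp)
  have hDp : ∀ u, D p (0, u) = u := (eventually_fderiv_inr_eq hm h2).self_of_nhds
  have hD2w : D2 (0, w) (0, w) = 0 := fderiv_fderiv_inr_inr hm h2 w w
  set B := D2 (v, 0) (0, w) with hB
  -- The 1 keeps C positive when w = 0.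
  set C := (‖v‖ + ‖w‖) * ‖w‖ + 1 with hC
  have hCpos : 0 < C := by positivity
  rw [Metric.tendsto_atTop']
  suffices h : ∀ ε > 0, ∀ᶠ N in atTop, ‖(t N ^ 2)⁻¹ • (m (x₀ + t N • v, x₀ + t N • w)
      - x₀ - t N • v - t N • w) - B‖ < ε by
    intro ε hε
    obtain ⟨n, hn⟩ := eventually_atTop.1 (h ε hε)
    exact ⟨n, fun k hk => by rw [dist_eq_norm]; exact hn k hk.le⟩
  intro ε hε
  have hε' : 0 < ε / C := div_pos hε hCpos
  obtain ⟨r, hr, hball⟩ := Metric.eventually_nhds_iff_ball.1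
    ((hD.isLittleO.def hε').and hd)
  have hT : Tendsto (fun N => t N * (‖v‖ + ‖w‖)) atTop (𝓝 0) := by
    simpa using ht.mul_const (‖v‖ + ‖w‖)
  have hxv : Tendsto (fun N => x₀ + t N • v) atTop (𝓝 x₀) := by
    simpa using (ht.smul_const v).const_add x₀
  filter_upwards [ht0, hT.eventually_lt_const hr, hxv.eventually h1] with N hN hNr hN1
  have hq : ∀ s ∈ Set.Icc 0 (t N), ‖(x₀ + t N • v, x₀ + s • w) - p‖ ≤ t N * (‖v‖ + ‖w‖) := by
    intro s hs
    rw [hp, Prod.mk_sub_mk, add_sub_cancel_left, add_sub_cancel_left]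
    refine max_le ?_ ?_
    · rw [norm_smul, Real.norm_of_nonneg hN.le]
      nlinarith [norm_nonneg w]
    · rw [norm_smul, Real.norm_of_nonneg hs.1]
      nlinarith [norm_nonneg w, norm_nonneg v, hs.2]
  have hqb : ∀ s ∈ Set.Icc 0 (t N), (x₀ + t N • v, x₀ + s • w) ∈ Metric.ball p r := fun s hs => by
    rw [mem_ball_iff_norm]; exact (hq s hs).trans_lt hNr
  -- The mean value inequality is applied in the second variable only, starting from m(x₀ + tv, x₀)
  -- = x₀ + tv. The derivative along w differs from w + tB by o(t), since the fderiv of m is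
  -- differentiable at (x₀, x₀).
  have hder : ∀ s ∈ Set.Icc 0 (t N),
      HasDerivWithinAt (fun s => m (x₀ + t N • v, x₀ + s • w) - s • (w + t N • B))
        (D (x₀ + t N • v, x₀ + s • w) (0, w) - (w + t N • B)) (Set.Icc 0 (t N)) s := by
    intro s hs
    have e1 : HasDerivAt (fun s : ℝ => (x₀ + t N • v, x₀ + s • w)) ((0 : E), w) s := by
      refine (hasDerivAt_const s _).prodMk ?_
      simpa using ((hasDerivAt_id s).smul_const w).const_add x₀
    have e2 := (hball _ (hqb s hs)).2.hasFDerivAt.comp_hasDerivAt s e1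
    have e3 : HasDerivAt (fun s : ℝ => s • (w + t N • B)) (w + t N • B) s := by
      simpa using (hasDerivAt_id s).smul_const (w + t N • B)
    exact (e2.sub e3).hasDerivWithinAt
  have hbound : ∀ s ∈ Set.Ico 0 (t N),
      ‖D (x₀ + t N • v, x₀ + s • w) (0, w) - (w + t N • B)‖
        ≤ ε / C * (t N * (‖v‖ + ‖w‖)) * ‖w‖ := by
    intro s hs
    have hs' := Set.Ico_subset_Icc_self hs
    have e1 : D (x₀ + t N • v, x₀ + s • w) (0, w) - (w + t N • B)
        = (D (x₀ + t N • v, x₀ + s • w) - D p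
          - D2 ((x₀ + t N • v, x₀ + s • w) - p)) (0, w) := by
      have e2 : ((x₀ + t N • v, x₀ + s • w) : E × E) - p = t N • (v, 0) + s • (0, w) := by
        rw [hp]; ext <;> simp
      rw [sub_apply, sub_apply, hDp, e2, map_add, map_smul, map_smul, add_apply, smul_apply,
        smul_apply, hD2w, smul_zero, add_zero, sub_sub]
    rw [e1]
    refine (ContinuousLinearMap.le_opNorm _ _).trans ?_
    rw [show ‖((0 : E), w)‖ = ‖w‖ by simp]
    refine mul_le_mul_of_nonneg_right ?_ (norm_nonneg _)
    exact (hball _ (hqb s hs')).1.trans (mul_le_mul_of_nonneg_left (hq s hs') hε'.le)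
  have hfin := norm_image_sub_le_of_norm_deriv_le_segment' hder hbound (t N)
    (Set.right_mem_Icc.2 hN.le)
  simp only [zero_smul, add_zero, sub_zero, hN1] at hfin
  have e3 : (t N ^ 2)⁻¹ • (m (x₀ + t N • v, x₀ + t N • w) - x₀ - t N • v - t N • w) - B
      = (t N ^ 2)⁻¹ • (m (x₀ + t N • v, x₀ + t N • w) - t N • (w + t N • B) - (x₀ + t N • v)) := by
    have : B = (t N ^ 2)⁻¹ • (t N ^ 2) • B := by
      rw [smul_smul, inv_mul_cancel₀ (by positivity), one_smul]
    conv_lhs => rw [this]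
    rw [← smul_sub]
    congr 1
    rw [smul_add, smul_smul, sq]
    abel
  rw [e3, norm_smul, Real.norm_of_nonneg (by positivity), inv_mul_lt_iff₀ (by positivity)]
  refine hfin.trans_lt ?_
  rw [show ε / C * (t N * (‖v‖ + ‖w‖)) * ‖w‖ * t N
    = t N ^ 2 * (ε / C * ((‖v‖ + ‖w‖) * ‖w‖)) by ring]
  refine mul_lt_mul_of_pos_left ?_ (by positivity)
  calc _ < ε / C * C := mul_lt_mul_of_pos_left (by rw [hC]; linarith) hε'
    _ = ε := div_mul_cancel₀ _ hCpos.ne'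

/-- The second order expansion of the commutator in a local group law. -/
theorem tendsto_inv_sq_smul_localCommutator (hm : ContDiffAt ℝ 2 m (x₀, x₀))
    (h1 : ∀ᶠ x in 𝓝 x₀, m (x, x₀) = x) (h2 : ∀ᶠ x in 𝓝 x₀, m (x₀, x) = x)
    (v w : E) {t : ℕ → ℝ} (ht0 : ∀ᶠ N in atTop, 0 < t N) (ht : Tendsto t atTop (𝓝 0))
    {c : ℕ → E} (hc : Tendsto c atTop (𝓝 x₀))
    (hmc : ∀ᶠ N in atTop, m (m (x₀ + t N • w, x₀ + t N • v), c N)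
      = m (x₀ + t N • v, x₀ + t N • w)) :
    Tendsto (fun N => (t N ^ 2)⁻¹ • (c N - x₀)) atTop
      (𝓝 (fderiv ℝ (fderiv ℝ m) (x₀, x₀) (v, 0) (0, w)
        - fderiv ℝ (fderiv ℝ m) (x₀, x₀) (w, 0) (0, v))) := by
  set L := fderiv ℝ (fderiv ℝ m) (x₀, x₀) (v, 0) (0, w)
        - fderiv ℝ (fderiv ℝ m) (x₀, x₀) (w, 0) (0, v) with hL
  set a : ℕ → E := fun N => m (x₀ + t N • v, x₀ + t N • w)
  set b : ℕ → E := fun N => m (x₀ + t N • w, x₀ + t N • v)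
  have hab : Tendsto (fun N => (t N ^ 2)⁻¹ • (a N - b N)) atTop (𝓝 L) := by
    refine ((tendsto_inv_sq_smul_localMul hm h1 h2 v w ht0 ht).sub
      (tendsto_inv_sq_smul_localMul hm h1 h2 w v ht0 ht)).congr fun N => ?_
    rw [← smul_sub]
    congr 1
    abel
  have hx : ∀ u, Tendsto (fun N => x₀ + t N • u) atTop (𝓝 x₀) := fun u => by
    simpa using (ht.smul_const u).const_add x₀
  have hb : Tendsto b atTop (𝓝 x₀) := by
    have h3 := hm.continuousAt.tendsto.comp ((hx w).prodMk_nhds (hx v))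
    rwa [h1.self_of_nhds] at h3
  -- Here a = m(b, c). Strict differentiability, which allows the base point b to move, gives m(b,
  -- c) - m(b, x₀) = c - x₀ + o(c - x₀).
  have hstr := (hm.hasStrictFDerivAt (by simp)).isLittleO
  have hlim : Tendsto (fun N => ((b N, c N), (b N, x₀))) atTop (𝓝 ((x₀, x₀), (x₀, x₀))) :=
    (hb.prodMk_nhds hc).prodMk_nhds (hb.prodMk_nhds tendsto_const_nhds)
  have ho := hstr.comp_tendsto hlim
  have hDp := (eventually_fderiv_inr_eq hm h2).self_of_nhds
  have ho2 : (fun N => (a N - b N) - (c N - x₀)) =o[atTop] fun N => c N - x₀ := by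
    refine (ho.congr' ?_ EventuallyEq.rfl).trans_isBigO ?_
    · filter_upwards [hmc, hb.eventually h1] with N hN hN2
      simp only [Function.comp_apply]
      rw [hN, hN2, Prod.mk_sub_mk, sub_self, hDp]
    · refine Asymptotics.IsBigO.of_bound 1 (Eventually.of_forall fun N => ?_)
      simp [Function.comp_apply]
  -- No rate for c is known beforehand; symmetry of the equivalence transfers the rate of a - b to
  -- it.
  have hequiv : Asymptotics.IsEquivalent atTop (fun N => a N - b N) fun N => c N - x₀ := ho2
  have ho3 : (fun N => (c N - x₀) - (a N - b N)) =o[atTop] fun N => a N - b N := hequiv.symm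
  have ho4 : (fun N => (t N ^ 2)⁻¹ • ((c N - x₀) - (a N - b N))) =o[atTop]
      fun N => (t N ^ 2)⁻¹ • (a N - b N) :=
    (Asymptotics.isBigO_refl (fun N => (t N ^ 2)⁻¹) atTop).smul_isLittleO ho3
  have ho5 := (ho4.trans_isBigO (hab.isBigO_one ℝ))
  rw [Asymptotics.isLittleO_one_iff] at ho5
  have h6 := ho5.add hab
  rw [zero_add] at h6
  refine h6.congr fun N => ?_
  rw [← smul_add, sub_add_cancel]

end LocalGroupLaw

/-! ### The Lie bracket in the chart at the identity -/

section LieGroup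

variable {E : Type*} [NormedAddCommGroup E] [NormedSpace ℝ E]
  {G : Type*} [Group G] [TopologicalSpace G] [ChartedSpace E G] [LieGroup 𝓘(ℝ, E) ∞ G]

variable (E G) in
/-- The group law in the chart at the identity. -/
noncomputable def chartMul (p : E × E) : E :=
  extChartAt 𝓘(ℝ, E) (1 : G) ((extChartAt 𝓘(ℝ, E) (1 : G)).symm p.1
    * (extChartAt 𝓘(ℝ, E) (1 : G)).symm p.2)

variable (E G) in
/-- The identity in the chart at the identity. -/
noncomputable def chartOne : E := extChartAt 𝓘(ℝ, E) (1 : G) 1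

omit [LieGroup 𝓘(ℝ, E) ∞ G] in
theorem extChartAt_symm_chartOne : (extChartAt 𝓘(ℝ, E) (1 : G)).symm (chartOne E G) = 1 :=
  extChartAt_to_inv (I := 𝓘(ℝ, E)) (1 : G)

omit [LieGroup 𝓘(ℝ, E) ∞ G] in
theorem extChartAt_target_mem_nhds_chartOne :
    (extChartAt 𝓘(ℝ, E) (1 : G)).target ∈ 𝓝 (chartOne E G) :=
  extChartAt_target_mem_nhds (I := 𝓘(ℝ, E)) (1 : G)

theorem contMDiffAt_extChartAt_symm_chartOne :
    ContMDiffAt 𝓘(ℝ, E) 𝓘(ℝ, E) ∞ (extChartAt 𝓘(ℝ, E) (1 : G)).symm (chartOne E G) := by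
  exact (contMDiffOn_extChartAt_symm (1 : G)).contMDiffAt extChartAt_target_mem_nhds_chartOne

theorem contDiffAt_chartMul : ContDiffAt ℝ ∞ (chartMul E G) (chartOne E G, chartOne E G) := by
  rw [← contMDiffAt_iff_contDiffAt]
  have h1 : ContMDiffAt 𝓘(ℝ, E × E) 𝓘(ℝ, E) ∞
      (fun p : E × E => (extChartAt 𝓘(ℝ, E) (1 : G)).symm p.1) (chartOne E G, chartOne E G) :=
    ContMDiffAt.comp (chartOne E G, chartOne E G) (f := Prod.fst) contMDiffAt_extChartAt_symm_chartOne
      contDiff_fst.contDiffAt.contMDiffAt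
  have h2 : ContMDiffAt 𝓘(ℝ, E × E) 𝓘(ℝ, E) ∞
      (fun p : E × E => (extChartAt 𝓘(ℝ, E) (1 : G)).symm p.2) (chartOne E G, chartOne E G) :=
    ContMDiffAt.comp (chartOne E G, chartOne E G) (f := Prod.snd) contMDiffAt_extChartAt_symm_chartOne
      contDiff_snd.contDiffAt.contMDiffAt
  have h3 := h1.mul h2
  refine ContMDiffAt.comp _ (g := extChartAt 𝓘(ℝ, E) (1 : G)) ?_ h3
  simp only [extChartAt_symm_chartOne, mul_one]
  exact contMDiffAt_extChartAt

omit [LieGroup 𝓘(ℝ, E) ∞ G] in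
theorem eventually_chartMul_right :
    ∀ᶠ x in 𝓝 (chartOne E G), chartMul E G (x, chartOne E G) = x := by
  filter_upwards [extChartAt_target_mem_nhds_chartOne] with x hx
  rw [chartMul, extChartAt_symm_chartOne, mul_one, PartialEquiv.right_inv _ hx]

omit [LieGroup 𝓘(ℝ, E) ∞ G] in
theorem eventually_chartMul_left :
    ∀ᶠ x in 𝓝 (chartOne E G), chartMul E G (chartOne E G, x) = x := by
  filter_upwards [extChartAt_target_mem_nhds_chartOne] with x hx
  rw [chartMul, extChartAt_symm_chartOne, one_mul, PartialEquiv.right_inv _ hx]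

omit [Group G] [LieGroup 𝓘(ℝ, E) ∞ G] in
theorem _root_.HasMFDerivAt.congr_point {f : G → E} {x y : G} {L : E →L[ℝ] E}
    (hf : HasMFDerivAt 𝓘(ℝ, E) 𝓘(ℝ, E) f x L) (h : x = y) :
    HasMFDerivAt 𝓘(ℝ, E) 𝓘(ℝ, E) f y L := by
  subst h; exact hf

/-- A left-invariant vector field in the chart at the identity. -/
theorem eventually_mpullbackWithin_mulInvariantVectorField (v : E) :
    ∀ᶠ x in 𝓝 (chartOne E G), VectorField.mpullbackWithin 𝓘(ℝ, E) 𝓘(ℝ, E)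
      (extChartAt 𝓘(ℝ, E) (1 : G)).symm (mulInvariantVectorField (I := 𝓘(ℝ, E)) (G := G) v)
        (Set.range 𝓘(ℝ, E)) x
      = fderiv ℝ (chartMul E G) (x, chartOne E G) (0, v) := by
  have hm : ContDiffAt ℝ 2 (chartMul E G) (chartOne E G, chartOne E G) :=
    contDiffAt_chartMul.of_le ENat.LEInfty.out
  have hd : ∀ᶠ q in 𝓝 (chartOne E G, chartOne E G), DifferentiableAt ℝ (chartMul E G) q :=
    (hm.eventually (by simp)).mono fun q hq => hq.differentiableAt (by simp)
  have hc : Tendsto (fun x => (x, chartOne E G)) (𝓝 (chartOne E G))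
      (𝓝 (chartOne E G, chartOne E G)) := (Continuous.prodMk_left _).tendsto _
  filter_upwards [hc.eventually hd, extChartAt_target_mem_nhds_chartOne] with x hx hxt
  set e := extChartAt 𝓘(ℝ, E) (1 : G) with he
  have hxs : e.symm x ∈ e.source := e.map_target hxt
  have h1 : HasFDerivAt (fun y => chartMul E G (x, y))
      ((fderiv ℝ (chartMul E G) (x, chartOne E G)).comp (ContinuousLinearMap.inr ℝ E E))
      (chartOne E G) :=
    HasFDerivAt.comp (chartOne E G) hx.hasFDerivAt (hasFDerivAt_prodMk_right x (chartOne E G))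
  have hone : e.symm (chartOne E G) = 1 := extChartAt_symm_chartOne
  let A : E →L[ℝ] E := mfderiv 𝓘(ℝ, E) 𝓘(ℝ, E) e.symm (chartOne E G)
  let B : E →L[ℝ] E := mfderiv 𝓘(ℝ, E) 𝓘(ℝ, E) (fun a : G => e.symm x * a) 1
  let C : E →L[ℝ] E := mfderiv 𝓘(ℝ, E) 𝓘(ℝ, E) e (e.symm x)
  let C' : E →L[ℝ] E := mfderivWithin 𝓘(ℝ, E) 𝓘(ℝ, E) e.symm (Set.range 𝓘(ℝ, E)) x
  have hA : A = ContinuousLinearMap.id ℝ E := by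
    have h := mfderivWithin_range_extChartAt_symm (I := 𝓘(ℝ, E)) (x := (1 : G))
    rw [ModelWithCorners.range_eq_univ, mfderivWithin_univ] at h
    exact h
  have hC1 : C.comp C' = ContinuousLinearMap.id ℝ E :=
    mfderiv_extChartAt_comp_mfderivWithin_extChartAt_symm (I := 𝓘(ℝ, E)) (x := (1 : G)) hxt
  have hC2 : C'.comp C = ContinuousLinearMap.id ℝ E :=
    mfderivWithin_extChartAt_symm_comp_mfderiv_extChartAt (I := 𝓘(ℝ, E)) (x := (1 : G)) hxt
  have m1 : HasMFDerivAt 𝓘(ℝ, E) 𝓘(ℝ, E) e.symm (chartOne E G) A :=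
    (contMDiffAt_extChartAt_symm_chartOne.mdifferentiableAt (by simp)).hasMFDerivAt
  have m2 : HasMFDerivAt 𝓘(ℝ, E) 𝓘(ℝ, E) (fun a : G => e.symm x * a) 1 B :=
    ((contMDiff_mul_left (I := 𝓘(ℝ, E)) (n := ∞)).contMDiffAt.mdifferentiableAt
      (by simp)).hasMFDerivAt
  have m3 : HasMFDerivAt 𝓘(ℝ, E) 𝓘(ℝ, E) e (e.symm x) C := by
    refine (contMDiffAt_extChartAt' (n := 1) ?_).mdifferentiableAt (by simp) |>.hasMFDerivAt
    simpa [e] using hxs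
  have m23 : HasMFDerivAt 𝓘(ℝ, E) 𝓘(ℝ, E) (fun a : G => e (e.symm x * a)) 1 (C.comp B) :=
    HasMFDerivAt.comp (1 : G) (m3.congr_point (mul_one _).symm) m2
  have m123 : HasMFDerivAt 𝓘(ℝ, E) 𝓘(ℝ, E) (fun y => chartMul E G (x, y)) (chartOne E G)
      ((C.comp B).comp A) :=
    HasMFDerivAt.comp (chartOne E G) (f := e.symm) (g := fun a : G => e (e.symm x * a))
      (m23.congr_point hone.symm) m1
  -- The derivative of y ↦ m(x, y) at the identity is computed once from m and once through the
  -- group; the chart derivative C inverts C', which turns the latter into the pullback.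
  have h2 := h1.unique (hasMFDerivAt_iff_hasFDerivAt.1 m123)
  have h3 := congrArg (fun L : E →L[ℝ] E => L v) h2
  simp only [hA] at h3
  change C'.inverse (B v) = _
  rw [ContinuousLinearMap.inverse_eq hC2 hC1]
  exact h3.symm

/-- In the chart the invariant field of v is x ↦ Dm(x, x₀)(0, v). Its derivative at x₀ is a mixed
second derivative of m and its value there is v. -/
theorem lie_eq_fderiv_fderiv_chartMul (v w : E) :
    Bracket.bracket (L := GroupLieAlgebra 𝓘(ℝ, E) G) (M := GroupLieAlgebra 𝓘(ℝ, E) G) v w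
      = fderiv ℝ (fderiv ℝ (chartMul E G)) (chartOne E G, chartOne E G) (v, 0) (0, w)
      - fderiv ℝ (fderiv ℝ (chartMul E G)) (chartOne E G, chartOne E G) (w, 0) (0, v) := by
  have hm : ContDiffAt ℝ 2 (chartMul E G) (chartOne E G, chartOne E G) :=
    contDiffAt_chartMul.of_le ENat.LEInfty.out
  have hDp := (eventually_fderiv_inr_eq hm eventually_chartMul_left).self_of_nhds
  refine (GroupLieAlgebra.bracket_def (I := 𝓘(ℝ, E)) (G := G) v w).trans ?_
  refine (VectorField.mlieBracketWithin_apply (I := 𝓘(ℝ, E)) (s := Set.univ) (x₀ := (1 : G))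
    (V := mulInvariantVectorField (I := 𝓘(ℝ, E)) (G := G) v)
    (W := mulInvariantVectorField (I := 𝓘(ℝ, E)) (G := G) w)).trans ?_
  have hid : (ContinuousLinearMap.inverse (mfderiv 𝓘(ℝ, E) 𝓘(ℝ, E)
      (extChartAt 𝓘(ℝ, E) (1 : G)) 1 : E →L[ℝ] E)) = ContinuousLinearMap.id ℝ E :=
    (congrArg (fun L : E →L[ℝ] E => L.inverse)
      (mfderiv_extChartAt_self (I := 𝓘(ℝ, E)) (x := (1 : G)))).trans
      ContinuousLinearMap.inverse_id
  refine (congrArg (fun L : E →L[ℝ] E => L _) hid).trans ?_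
  change VectorField.lieBracketWithin ℝ _ _ _ (chartOne E G) = _
  rw [Set.preimage_univ, Set.univ_inter, ModelWithCorners.range_eq_univ]
  refine (congrFun (VectorField.lieBracketWithin_univ (𝕜 := ℝ) (E := E)) (chartOne E G)).trans ?_
  have hv := eventually_mpullbackWithin_mulInvariantVectorField (G := G) v
  have hw := eventually_mpullbackWithin_mulInvariantVectorField (G := G) w
  rw [ModelWithCorners.range_eq_univ] at hv hw
  refine (Filter.EventuallyEq.lieBracket_vectorField_eq (𝕜 := ℝ) hv hw).trans ?_
  rw [VectorField.lieBracket, (hasFDerivAt_fderiv_inl hm w).fderiv,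
    (hasFDerivAt_fderiv_inl hm v).fderiv, hDp, hDp]
  rfl

/-- The commutator of two curves through the identity with velocities `v` and `w` is to second
order the Lie bracket of `v` and `w`. -/
theorem tendsto_inv_sq_smul_commutator (v w : E) {t : ℕ → ℝ}
    (ht0 : ∀ᶠ N in atTop, 0 < t N) (ht : Tendsto t atTop (𝓝 0)) {g k : ℕ → G}
    (hg : ∀ N, g N = (extChartAt 𝓘(ℝ, E) (1 : G)).symm (chartOne E G + t N • v))
    (hk : ∀ N, k N = (extChartAt 𝓘(ℝ, E) (1 : G)).symm (chartOne E G + t N • w)) :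
    Tendsto (fun N => (g N)⁻¹ * (k N)⁻¹ * g N * k N) atTop (𝓝 1) ∧
    Tendsto (fun N => (t N ^ 2)⁻¹ • (extChartAt 𝓘(ℝ, E) (1 : G)
      ((g N)⁻¹ * (k N)⁻¹ * g N * k N) - chartOne E G)) atTop (𝓝 (Bracket.bracket
      (L := GroupLieAlgebra 𝓘(ℝ, E) G) (M := GroupLieAlgebra 𝓘(ℝ, E) G) v w : E)) := by
  have : IsTopologicalGroup G := topologicalGroup_of_lieGroup 𝓘(ℝ, E) ∞
  have hlim : ∀ u : E, Tendsto (fun N => (extChartAt 𝓘(ℝ, E) (1 : G)).symm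
      (chartOne E G + t N • u)) atTop (𝓝 1) := fun u => by
    have h1 : Tendsto (fun N => chartOne E G + t N • u) atTop (𝓝 (chartOne E G)) := by
      simpa using (ht.smul_const u).const_add (chartOne E G)
    have h2 := (continuousAt_extChartAt_symm (I := 𝓘(ℝ, E)) (1 : G)).tendsto.comp h1
    rwa [extChartAt_to_inv] at h2
  have hg1 : Tendsto g atTop (𝓝 1) := (hlim v).congr fun N => (hg N).symm
  have hk1 : Tendsto k atTop (𝓝 1) := (hlim w).congr fun N => (hk N).symm
  have hc1 : Tendsto (fun N => (g N)⁻¹ * (k N)⁻¹ * g N * k N) atTop (𝓝 1) := by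
    have := ((hg1.inv.mul hk1.inv).mul hg1).mul hk1
    simpa using this
  have hkg : Tendsto (fun N => k N * g N) atTop (𝓝 1) := by
    simpa using hk1.mul hg1
  refine ⟨hc1, ?_⟩
  rw [lie_eq_fderiv_fderiv_chartMul]
  have hsrc := extChartAt_source_mem_nhds (I := 𝓘(ℝ, E)) (1 : G)
  refine tendsto_inv_sq_smul_localCommutator
    (contDiffAt_chartMul.of_le ENat.LEInfty.out) eventually_chartMul_right
    eventually_chartMul_left v w ht0 ht ?_ ?_
  · exact (continuousAt_extChartAt (I := 𝓘(ℝ, E)) (1 : G)).tendsto.comp hc1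
  · filter_upwards [hc1.eventually hsrc, hkg.eventually hsrc] with N hN hN2
    simp only [chartMul, ← hg, ← hk]
    rw [PartialEquiv.left_inv _ hN2, PartialEquiv.left_inv _ hN]
    congr 1
    group

end LieGroup

/-! ### Polarization and exponents -/

section Vectors

variable {H : Type*} [NormedAddCommGroup H] [InnerProductSpace ℂ H]

/-- The covariance is the polarization of the variance; this uses that ⟨ψ|a⟩ and ⟨ψ|b⟩ are
imaginary. -/
theorem half_anticommutator_sub_mul_eq {ψ a b : H} (ha : (inner ℂ ψ a).re = 0)
    (hb : (inner ℂ ψ b).re = 0) :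
    1 / 2 * (inner ℂ (-Complex.I • a) (-Complex.I • b) + inner ℂ (-Complex.I • b) (-Complex.I • a))
      - inner ℂ ψ (-Complex.I • a) * inner ℂ ψ (-Complex.I • b)
    = (((orthNormSq ψ (a + b) - orthNormSq ψ a - orthNormSq ψ b) / 2 : ℝ) : ℂ) := by
  have h1 : orthNormSq ψ (a + b) - orthNormSq ψ a - orthNormSq ψ b
      = 2 * ((inner ℂ a b).re - (inner ℂ ψ a).im * (inner ℂ ψ b).im) := by
    rw [orthNormSq, orthNormSq, orthNormSq, norm_add_sq (𝕜 := ℂ), inner_add_right,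
      ← Complex.normSq_eq_norm_sq, ← Complex.normSq_eq_norm_sq, ← Complex.normSq_eq_norm_sq,
      Complex.normSq_apply, Complex.normSq_apply, Complex.normSq_apply, Complex.add_re,
      Complex.add_im, ha, hb]
    simp only [RCLike.re_to_complex]
    ring
  have hI : (starRingEnd ℂ) (-Complex.I) * -Complex.I = 1 := by
    rw [map_neg, Complex.conj_I, neg_neg, mul_neg, Complex.I_mul_I, neg_neg]
  rw [h1, inner_smul_left, inner_smul_left, inner_smul_right, inner_smul_right, inner_smul_right,
    inner_smul_right, ← mul_assoc, ← mul_assoc, hI, ← inner_conj_symm b a]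
  have e1 := Complex.add_conj (inner ℂ a b)
  have e2 : inner ℂ ψ a = ((inner ℂ ψ a).im : ℂ) * Complex.I := by
    conv_lhs => rw [← Complex.re_add_im (inner ℂ ψ a), ha]
    simp
  have e3 : inner ℂ ψ b = ((inner ℂ ψ b).im : ℂ) * Complex.I := by
    conv_lhs => rw [← Complex.re_add_im (inner ℂ ψ b), hb]
    simp
  rw [one_mul, one_mul, e1, e2, e3]
  simp only [Complex.im_ofReal_mul, Complex.I_im, mul_one]
  push_cast
  linear_combination (-1 : ℂ) * ((inner ℂ ψ a).im : ℂ) * ((inner ℂ ψ b).im : ℂ)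
    * (Complex.I ^ 2 - 1) * Complex.I_sq

/-- One equality of exponentials leaves a multiple of 2πi open; differentiating in τ at 0 removes
it. -/
theorem eq_of_forall_exp_eq {a b : ℂ}
    (h : ∀ τ : ℝ, Complex.exp (τ * a) = Complex.exp (τ * b)) : a = b := by
  have hd : ∀ c : ℂ, HasDerivAt (fun τ : ℝ => Complex.exp (τ * c)) c 0 := fun c => by
    have h1 : HasDerivAt (fun τ : ℝ => (τ : ℂ) * c) c 0 := by
      simpa using (Complex.ofRealCLM.hasDerivAt (x := (0 : ℝ))).mul_const c
    simpa using h1.cexp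
  exact (hd a).unique ((hd b).congr_of_eventuallyEq (Eventually.of_forall h))

end Vectors

/-! ### Orbit maps and the moments of the generators -/

section Orbit

variable {E : Type*} [NormedAddCommGroup E] [NormedSpace ℝ E]
  {G : Type v} [Group G] [TopologicalSpace G] [ChartedSpace E G]

variable (E) in
/-- The derivative at the identity of the orbit map of a vector. -/
noncomputable def orbitDeriv (S : System.{u, v} G) (ψ : S.carrier) : E →L[ℝ] S.carrier :=
  mfderiv 𝓘(ℝ, E) 𝓘(ℝ, S.carrier) (fun g : G => S.U g ψ) 1

theorem expect_eq (S : System.{u, v} G) (ψ : S.carrier) (X : E) :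
    expect (E := E) S X ψ = -Complex.I * inner ℂ ψ (orbitDeriv E S ψ X) := by
  change inner ℂ ψ ((-Complex.I) • orbitDeriv E S ψ X) = _
  rw [inner_smul_right]

variable (E) in
/-- The linear form `X ↦ ⟨ψ|dU(X)ψ⟩`. -/
noncomputable def orbitForm (S : System.{u, v} G) (ψ : S.carrier) : E →ₗ[ℝ] ℂ where
  toFun X := inner ℂ ψ (orbitDeriv E S ψ X)
  map_add' X Y := by rw [map_add, inner_add_right]
  map_smul' c X := by
    rw [map_smul, ← algebraMap_smul ℂ c (orbitDeriv E S ψ X), inner_smul_right,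
      RingHom.id_apply, Complex.real_smul, Complex.coe_algebraMap]

variable (E) in
/-- The linear form `X ↦ ⟨ψ|dU(X)ψ⟩` on the Lie algebra. -/
noncomputable def lieForm (S : System.{u, v} G) (ψ : S.carrier) :
    GroupLieAlgebra 𝓘(ℝ, E) G →ₗ[ℝ] ℂ :=
  orbitForm E S ψ

theorem expect_eq_lieForm (S : System.{u, v} G) (ψ : S.carrier) (X : GroupLieAlgebra 𝓘(ℝ, E) G) :
    expect S X ψ = -Complex.I * lieForm E S ψ X :=
  expect_eq (E := E) S ψ X

theorem InGeneratorDomain.hasFDerivAt {S : System.{u, v} G} {ψ : S.carrier}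
    (h : InGeneratorDomain E S ψ) :
    HasFDerivAt (fun x => S.U ((extChartAt 𝓘(ℝ, E) (1 : G)).symm x) ψ) (orbitDeriv E S ψ)
      (chartOne E G) := by
  have h1 : HasFDerivWithinAt (fun x => S.U ((extChartAt 𝓘(ℝ, E) (1 : G)).symm x) ψ)
      (orbitDeriv E S ψ) (Set.range 𝓘(ℝ, E)) (chartOne E G) :=
    (MDifferentiableAt.hasMFDerivAt h).2
  rwa [ModelWithCorners.range_eq_univ, hasFDerivWithinAt_univ] at h1

/-- First order expansion of the orbit map along a sequence approaching the identity. -/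
theorem InGeneratorDomain.tendsto_smul {S : System.{u, v} G} {ψ : S.carrier}
    (h : InGeneratorDomain E S ψ) {c : ℕ → ℝ} (hc : Tendsto c atTop atTop) {x : ℕ → E} {X : E}
    (hx : Tendsto (fun N => c N • (x N - chartOne E G)) atTop (𝓝 X)) :
    Tendsto (fun N => c N • (S.U ((extChartAt 𝓘(ℝ, E) (1 : G)).symm (x N)) ψ - ψ)) atTop
      (𝓝 (orbitDeriv E S ψ X)) := by
  have h1 := (hasFDerivWithinAt_univ.2 h.hasFDerivAt).lim (tendsto_zero_of_tendsto_smul hc hx)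
    (Eventually.of_forall fun _ => Set.mem_univ _) hx
  refine h1.congr fun N => ?_
  rw [add_sub_cancel, extChartAt_symm_chartOne, map_one]
  rfl

theorem tendsto_sqrt_natCast : Tendsto (fun N : ℕ => √(N : ℝ)) atTop atTop :=
  Real.tendsto_sqrt_atTop.comp tendsto_natCast_atTop_atTop

variable (G) in
/-- A sequence of group elements approaching the identity along `X` at speed `1 / √N`. -/
noncomputable def approachSeq (X : E) (N : ℕ) : G :=
  (extChartAt 𝓘(ℝ, E) (1 : G)).symm (chartOne E G + (√(N : ℝ))⁻¹ • X)

theorem InGeneratorDomain.tendsto_sqrt_smul {S : System.{u, v} G} {ψ : S.carrier}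
    (h : InGeneratorDomain E S ψ) (X : E) :
    Tendsto (fun N : ℕ => √(N : ℝ) • (S.U (approachSeq G X N) ψ - ψ)) atTop
      (𝓝 (orbitDeriv E S ψ X)) := by
  refine h.tendsto_smul tendsto_sqrt_natCast (tendsto_const_nhds.congr' ?_)
  filter_upwards [tendsto_sqrt_natCast.eventually_gt_atTop 0] with N hN
  rw [add_sub_cancel_left, smul_smul, mul_inv_cancel₀ hN.ne', one_smul]

theorem InGeneratorDomain.tendsto_smul_commutator [LieGroup 𝓘(ℝ, E) ∞ G]
    {S : System.{u, v} G} {ψ : S.carrier} (h : InGeneratorDomain E S ψ) (X Y : E) :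
    Tendsto (fun N : ℕ => (N : ℝ) • (S.U ((approachSeq G X N)⁻¹ * (approachSeq G Y N)⁻¹
      * approachSeq G X N * approachSeq G Y N) ψ - ψ)) atTop
      (𝓝 (orbitDeriv E S ψ (Bracket.bracket (L := GroupLieAlgebra 𝓘(ℝ, E) G)
        (M := GroupLieAlgebra 𝓘(ℝ, E) G) X Y))) := by
  obtain ⟨h1, h2⟩ := tendsto_inv_sq_smul_commutator (G := G) X Y
    (t := fun N : ℕ => (√(N : ℝ))⁻¹)
    ((tendsto_sqrt_natCast.eventually_gt_atTop 0).mono fun N hN => inv_pos.2 hN)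
    (tendsto_inv_atTop_zero.comp tendsto_sqrt_natCast)
    (g := approachSeq G X) (k := approachSeq G Y) (fun _ => rfl) (fun _ => rfl)
  simp only [inv_pow, inv_inv, Real.sq_sqrt (Nat.cast_nonneg _)] at h2
  refine (h.tendsto_smul tendsto_natCast_atTop_atTop h2).congr' ?_
  filter_upwards [h1.eventually (extChartAt_source_mem_nhds (I := 𝓘(ℝ, E)) (1 : G))] with N hN
  rw [PartialEquiv.left_inv _ hN]

/-- For unit vectors Re⟨ψ|u-ψ⟩ = -‖u-ψ‖²/2, which is of second order. This is the symmetry of the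
generator, obtained without one-parameter groups. -/
theorem InGeneratorDomain.re_inner_orbitDeriv {S : System.{u, v} G} {ψ : S.carrier}
    (hψ : ‖ψ‖ = 1) (h : InGeneratorDomain E S ψ) (X : E) :
    (inner ℂ ψ (orbitDeriv E S ψ X)).re = 0 := by
  have h1 := h.tendsto_sqrt_smul X
  have h0 := tendsto_zero_of_tendsto_smul tendsto_sqrt_natCast h1
  have h2 := (Complex.continuous_re.tendsto _).comp
    (Tendsto.inner (𝕜 := ℂ) (tendsto_const_nhds (x := ψ)) h1)
  have h3 := ((h1.norm.mul h0.norm).div_const 2).neg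
  rw [norm_zero, mul_zero, zero_div, neg_zero] at h3
  refine tendsto_nhds_unique h2 (h3.congr fun N => ?_)
  set u := S.U (approachSeq G X N) ψ with hu
  have hun : ‖u‖ = 1 := by rw [hu, LinearIsometryEquiv.norm_map, hψ]
  have e : (inner ℂ ψ (u - ψ)).re = -(‖u - ψ‖ ^ 2 / 2) := by
    have e1 := norm_sub_sq (𝕜 := ℂ) u ψ
    rw [hun, hψ] at e1
    have e2 : RCLike.re (inner ℂ u ψ) = (inner ℂ ψ u).re := inner_re_symm (𝕜 := ℂ) u ψ
    rw [inner_sub_right, inner_self_eq_norm_sq_to_K, hψ, Complex.sub_re]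
    simp only [Complex.coe_algebraMap, Complex.ofReal_one, one_pow, Complex.one_re]
    linarith
  rw [Function.comp_apply, ← algebraMap_smul ℂ (√(N : ℝ)) (u - ψ), Complex.coe_algebraMap,
    inner_smul_right, Complex.re_ofReal_mul, e, norm_smul, Complex.norm_real,
    Real.norm_of_nonneg (Real.sqrt_nonneg _)]
  ring

variable {S : System.{u, v} G} {T : System.{w, v} G}
  {ψ : S.carrier} {hψ : ‖ψ‖ = 1} {φ : T.carrier} {hφ : ‖φ‖ = 1} {R : ℝ}

theorem ReversiblyConvertible.orthNormSq_orbitDeriv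
    (h : ReversiblyConvertible S T ψ hψ φ hφ R) (hR : 0 < R)
    (hSψ : InGeneratorDomain E S ψ) (hTφ : InGeneratorDomain E T φ) (X : E) :
    orthNormSq ψ (orbitDeriv E S ψ X) = R * orthNormSq φ (orbitDeriv E T φ X) := by
  refine le_antisymm ?_ (h.1.mul_orthNormSq_le hR (hSψ.tendsto_sqrt_smul X)
    (hTφ.tendsto_sqrt_smul X))
  have h2 := h.2.mul_orthNormSq_le (inv_pos.2 hR) (hTφ.tendsto_sqrt_smul X)
    (hSψ.tendsto_sqrt_smul X)
  rwa [inv_mul_le_iff₀ hR] at h2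

theorem ReversiblyConvertible.half_anticommutator_eq
    (h : ReversiblyConvertible S T ψ hψ φ hφ R) (hR : 0 < R)
    (hSψ : InGeneratorDomain E S ψ) (hTφ : InGeneratorDomain E T φ) (X Y : E) :
    1 / 2 * (inner ℂ (-Complex.I • orbitDeriv E S ψ X) (-Complex.I • orbitDeriv E S ψ Y)
        + inner ℂ (-Complex.I • orbitDeriv E S ψ Y) (-Complex.I • orbitDeriv E S ψ X))
      - inner ℂ ψ (-Complex.I • orbitDeriv E S ψ X) * inner ℂ ψ (-Complex.I • orbitDeriv E S ψ Y)
    = R • (1 / 2 * (inner ℂ (-Complex.I • orbitDeriv E T φ X) (-Complex.I • orbitDeriv E T φ Y)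
        + inner ℂ (-Complex.I • orbitDeriv E T φ Y) (-Complex.I • orbitDeriv E T φ X))
      - inner ℂ φ (-Complex.I • orbitDeriv E T φ X)
        * inner ℂ φ (-Complex.I • orbitDeriv E T φ Y)) := by
  rw [half_anticommutator_sub_mul_eq (hSψ.re_inner_orbitDeriv hψ X) (hSψ.re_inner_orbitDeriv hψ Y),
    half_anticommutator_sub_mul_eq (hTφ.re_inner_orbitDeriv hφ X) (hTφ.re_inner_orbitDeriv hφ Y),
    ← map_add, ← map_add, h.orthNormSq_orbitDeriv hR hSψ hTφ, h.orthNormSq_orbitDeriv hR hSψ hTφ,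
    h.orthNormSq_orbitDeriv hR hSψ hTφ, Complex.real_smul, ← Complex.ofReal_mul]
  congr 1
  ring

theorem ReversiblyConvertible.covMatrix_eq
    (h : ReversiblyConvertible S T ψ hψ φ hφ R) (hR : 0 < R)
    (hSψ : InGeneratorDomain E S ψ) (hTφ : InGeneratorDomain E T φ) {κ : Type*}
    (b : Module.Basis κ ℝ (GroupLieAlgebra 𝓘(ℝ, E) G)) :
    covMatrix S b ψ = R • covMatrix T b φ := by
  ext k l
  exact h.half_anticommutator_eq hR hSψ hTφ (b k) (b l)

variable [CompleteSpace E] [LieGroup 𝓘(ℝ, E) ∞ G]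

theorem ReversiblyConvertible.lieForm_bracket_eq
    (h : ReversiblyConvertible S T ψ hψ φ hφ R) (hR : 0 < R)
    (hSψ : InGeneratorDomain E S ψ) (hTφ : InGeneratorDomain E T φ)
    (X Y : GroupLieAlgebra 𝓘(ℝ, E) G) :
    lieForm E S ψ ⁅X, Y⁆ = R * lieForm E T φ ⁅X, Y⁆ := by
  refine eq_of_forall_exp_eq fun τ => ?_
  -- Replacing X by τX multiplies the bracket, hence both exponents, by τ.
  have h1 : Complex.exp (lieForm E S ψ ⁅τ • X, Y⁆) = Complex.exp (R * lieForm E T φ ⁅τ • X, Y⁆) :=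
    h.1.exp_inner_eq hR (hSψ.tendsto_sqrt_smul (τ • X : GroupLieAlgebra 𝓘(ℝ, E) G))
      (hTφ.tendsto_sqrt_smul (τ • X : GroupLieAlgebra 𝓘(ℝ, E) G))
      (h.orthNormSq_orbitDeriv hR hSψ hTφ _)
      (hSψ.tendsto_sqrt_smul Y) (hTφ.tendsto_sqrt_smul Y) (h.orthNormSq_orbitDeriv hR hSψ hTφ _)
      (hSψ.tendsto_smul_commutator _ _) (hTφ.tendsto_smul_commutator _ _)
  rw [smul_lie, map_smul, map_smul, Complex.real_smul, Complex.real_smul, mul_left_comm] at h1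
  exact h1

theorem ReversiblyConvertible.expect_eq_of_mem_commutator
    (h : ReversiblyConvertible S T ψ hψ φ hφ R) (hR : 0 < R)
    (hSψ : InGeneratorDomain E S ψ) (hTφ : InGeneratorDomain E T φ)
    {X : GroupLieAlgebra 𝓘(ℝ, E) G} (hX : X ∈ (⁅(⊤ : LieIdeal ℝ (GroupLieAlgebra 𝓘(ℝ, E) G)),
      (⊤ : LieIdeal ℝ (GroupLieAlgebra 𝓘(ℝ, E) G))⁆ : LieIdeal ℝ (GroupLieAlgebra 𝓘(ℝ, E) G))) :
    expect S X ψ = R * expect T X φ := by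
  have key : lieForm E S ψ X = R * lieForm E T φ X := by
    -- The commutator ideal is the linear span of brackets, and both sides are linear in X.
    rw [← LieSubmodule.mem_toSubmodule, LieSubmodule.lieIdeal_oper_eq_linear_span'] at hX
    induction hX using Submodule.span_induction with
    | mem X hX =>
      obtain ⟨Y, -, Z, -, rfl⟩ := hX
      exact h.lieForm_bracket_eq hR hSψ hTφ Y Z
    | zero => rw [map_zero, map_zero, mul_zero]
    | add X Y _ _ hX hY => rw [map_add, map_add, hX, hY, mul_add]
    | smul c X _ hX => rw [map_smul, map_smul, hX, Complex.real_smul, Complex.real_smul, mul_left_comm]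
  rw [expect_eq_lieForm, expect_eq_lieForm, key]
  ring

end Orbit

end Asymmetry

theorem theorem5
    {d : ℕ}
    {G : Type*} [Group G] [TopologicalSpace G] [ChartedSpace (EuclideanSpace ℝ (Fin d)) G]
    [LieGroup (𝓡 d) ∞ G] [CompactSpace G] [T2Space G]
    (S : Asymmetry.System G) (T : Asymmetry.System G)
    (hS : ∀ v : S.carrier, Continuous fun g => S.U g v)
    (hT : ∀ v : T.carrier, Continuous fun g => T.U g v)
    (ψ : S.carrier) (hψ : ‖ψ‖ = 1) (φ : T.carrier) (hφ : ‖φ‖ = 1)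
    (R : ℝ) (hR : 0 < R)
    (h : Asymmetry.ReversiblyConvertible S T ψ hψ φ hφ R) :
    Asymmetry.sym S (Asymmetry.pureState ψ hψ) = Asymmetry.sym T (Asymmetry.pureState φ hφ) ∧
    (Asymmetry.InGeneratorDomain (EuclideanSpace ℝ (Fin d)) S ψ → Asymmetry.InGeneratorDomain (EuclideanSpace ℝ (Fin d)) T φ →
      (∀ {κ : Type*} (b : Module.Basis κ ℝ (GroupLieAlgebra (𝓡 d) G)),
        Asymmetry.covMatrix S b ψ = R • Asymmetry.covMatrix T b φ) ∧
      (∀ X ∈ (⁅(⊤ : LieIdeal ℝ (GroupLieAlgebra (𝓡 d) G)),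
          (⊤ : LieIdeal ℝ (GroupLieAlgebra (𝓡 d) G))⁆ :
            LieIdeal ℝ (GroupLieAlgebra (𝓡 d) G)),
        Asymmetry.expect S X ψ = R * Asymmetry.expect T X φ)) := by
  refine ⟨Set.Subset.antisymm (h.1.sym_subset hR) (h.2.sym_subset (inv_pos.2 hR)),
    fun hSψ hTφ => ⟨fun b => h.covMatrix_eq hR hSψ hTφ b, fun X hX => ?_⟩⟩
  exact h.expect_eq_of_mem_commutator hR hSψ hTφ hX
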